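/- Let $d\ge 1$ and let $\mathcal V$ be $\mathbb R^d$ (continuum model) or $\mathbb Z^d$ (lattice model). Let $(V_\omega)_{\omega\in\Omega}$ be a random potential on $\mathcal V$, i.e. a family of real functions on $\mathcal V$ indexed by a probability space $(\Omega,\mathbb P)$, and let $H_\omega=-\Delta+V_\omega$, where in the lattice case $(-\Delta\varphi)(x)=\sum_{|y-x|=1}(\varphi(x)-\varphi(y))$. For a bounded domain $\Lambda\subset\mathcal V$ (a bounded open set, respectively a finite set of sites) let $H_\omega(\Lambda,n)$ be the Hamiltonian $\sum_{i=1}^n\bigl(-\Delta_i+V_\omega(x^i)\bigr)$ of $n$ noninteracting fermions in $\Lambda$ with Dirichlet boundary conditions, acting on the antisymmetric subspace $L^2_-(\Lambda^n)$; in the continuum it is the operator associated with the closed quadratic form $\sum_i\int|\nabla_i\varphi|^2+\int\sum_iV_\omega(x^i)|\varphi|^2$ on the antisymmetric functions in $H^1_0(\Lambda^n)$ for which it is finite. Let $$\mathfrak E_\omega(\Lambda,n)=\inf_{0\ne\varphi\in\mathrm{Dom}\,H_\omega(\Lambda,n)}\frac{\langle H_\omega(\Lambda,n)\varphi,\varphi\rangle}{\|\varphi\|^2}\in(-\infty,+\infty]$$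 be its ground state energy ($+\infty$ if there is no such $\varphi$). For $\rho>0$, the thermodynamic limit at density $\rho$ means $n/|\Lambda|\to\rho$ and $\Lambda\to\infty$ in the sense of Fisher: $|\Lambda|\to\infty$, and there is a function $\pi$ with $\lim_{\alpha\to0^+}\pi(\alpha)=0$ such that, for all sufficiently small $\alpha>0$ and all $\Lambda$ of the sequence, the $\alpha\,\mathrm{diam}(\Lambda)$-neighbourhood of $\partial\Lambda$ has volume at most $\pi(\alpha)|\Lambda|$ (a lattice domain is identified with the union of the unit cells of its sites). The energy density $\mathcal E(\rho,0)\in[-\infty,+\infty]$ is the non-random limit of $\mathfrak E_\omega(\Lambda,n)/n$ in the thermodynamic limit at density $\rho$; convergence is understood in probability, which is implied by convergence in $L^2$, in $L^1$ or almost surely. There is a constant $\beta=\beta(d)>0$ such that, for every $\rho>0$ and every random potential with $V_\omega\ge0$ almost surely, in both models, $$\mathcal E(\rho,0)\ \ge\ \beta\,\rho^{2/d}$$ whenever the limit $\mathcal E(\rho,0)$ exists. Moreover, whether or not this limit exists, for almost every $\omega$, $$\liminf\ \frac{\mathfrak E_\omega(\Lambda,n)}{n}\ \ge\ \beta\,\rho^{2/d}$$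 along every sequence $(\Lambda,n)$ in the thermodynamic limit at density $\rho$. -/

import Mathlib

open MeasureTheory Filter Topology
open scoped ComplexConjugate

namespace FermionGas

/-! ## Domains tending to infinity and the thermodynamic limit -/

/-- The one-particle configuration space of the continuum model, with the Euclidean norm. -/
abbrev Space (d : ℕ) : Type := EuclideanSpace ℝ (Fin d)

/-- The sets `Λ k` tend to infinity in the sense of Fisher: their volumes tend to infinity and
there is a shape function `π` with `π α → 0` as `α → 0`, such that for all small `α > 0` and
all `k` the open `α * diam (Λ k)`-neighbourhood of the boundary of `Λ k` has volume at most
`π α * |Λ k|`. -/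
def TendsToInfinityFisher {d : ℕ} (Λ : ℕ → Set (Space d)) : Prop :=
  Tendsto (fun k => volume (Λ k)) atTop (𝓝 ⊤) ∧
  ∃ π : ℝ → ℝ, Tendsto π (𝓝[>] 0) (𝓝 0) ∧
    ∃ α₀ > 0, ∀ α : ℝ, 0 < α → α < α₀ → ∀ k,
      volume (Metric.thickening (α * Metric.diam (Λ k)) (frontier (Λ k))) ≤
        ENNReal.ofReal (π α) * volume (Λ k)

/-- The thermodynamic limit at density `ρ`: `Λ → ∞` in the sense of Fisher, `n / |Λ| → ρ`. -/
def ThermodynamicLimit {d : ℕ} (Λ : ℕ → Set (Space d)) (n : ℕ → ℕ) (ρ : ℝ) : Prop :=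
  TendsToInfinityFisher Λ ∧
  Tendsto (fun k => (n k : ℝ) / (volume (Λ k)).toReal) atTop (𝓝 ρ)

/-- `e` is the limiting energy density at particle density `ρ` of the random energies
`𝓔 ω Λ n` (`n` particles in the domain `Λ`): along every thermodynamic limit `𝓔 ω Λ n / n`
converges to the non-random number `e`. The values may be infinite, so convergence is required
in probability in the extended reals; it follows from `L²`, from `L¹` and from almost sure
convergence. `region Λ` is the subset of Euclidean space occupied by the domain `Λ`. -/
def IsEnergyDensity {Ω : Type*} [MeasurableSpace Ω] (P : Measure Ω) {d : ℕ} {D : Type}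
    (region : D → Set (Space d)) (𝓔 : Ω → D → ℕ → EReal) (ρ : ℝ) (e : EReal) : Prop :=
  ∀ (Λ : ℕ → D) (n : ℕ → ℕ), ThermodynamicLimit (fun k => region (Λ k)) n ρ →
    ∀ U ∈ 𝓝 e,
      Tendsto (fun k => P {ω | 𝓔 ω (Λ k) (n k) / ((n k : ℝ) : EReal) ∉ U}) atTop (𝓝 0)

/-! ## Noninteracting fermions on `ℝ ^ d` -/

/-- Bounded open subsets of `ℝ ^ d`. -/
structure Domain (d : ℕ) : Type where
  carrier : Set (Space d)
  isOpen : IsOpen carrier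
  isBounded : Bornology.IsBounded carrier

/-- Positions of `n` particles. -/
abbrev Config (d n : ℕ) : Type := Fin n → Space d

/-- The set `Λ ^ n` of configurations of `n` particles in `Λ`. -/
def boxPow {d : ℕ} (Λ : Domain d) (n : ℕ) : Set (Config d n) :=
  Set.univ.pi fun _ => Λ.carrier

/-- Lebesgue measure on `Λ ^ n`. -/
noncomputable def boxMeasure {d : ℕ} (Λ : Domain d) (n : ℕ) : Measure (Config d n) :=
  (volume : Measure (Config d n)).restrict (boxPow Λ n)

/-- The Hilbert space `L²(Λ ^ n)` of complex-valued wave functions. -/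
abbrev L2 {d : ℕ} (Λ : Domain d) (n : ℕ) : Type := Lp ℂ 2 (boxMeasure Λ n)

/-- The fermionic wave functions: permuting the particles multiplies the function by the sign
of the permutation. -/
def IsAntisymmetric {d : ℕ} {Λ : Domain d} {n : ℕ} (φ : L2 Λ n) : Prop :=
  ∀ s : Equiv.Perm (Fin n), ∀ᵐ x ∂(boxMeasure Λ n),
    φ (fun i => x (s i)) = (((Equiv.Perm.sign s : ℤ) : ℂ)) * φ x

/-- Pairs `(g, ∇ g)` with `g` smooth with compact support in `Λ ^ n`; the component `(i, j)` of
the gradient is the derivative in the `j`-th coordinate of the `i`-th particle. -/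
def testGraph {d : ℕ} (Λ : Domain d) (n : ℕ) : Set (L2 Λ n × (Fin n → Fin d → L2 Λ n)) :=
  {p | ∃ g : Config d n → ℂ, ContDiff ℝ (⊤ : ℕ∞) g ∧ HasCompactSupport g ∧ tsupport g ⊆ boxPow Λ n ∧
    p.1 =ᵐ[boxMeasure Λ n] g ∧
    ∀ i j, p.2 i j =ᵐ[boxMeasure Λ n]
      fun x => fderiv ℝ g x (Pi.single i (EuclideanSpace.single j 1))}

/-- `φ` belongs to the Sobolev space `H¹₀(Λ ^ n)` (the closure of the test functions in the
`H¹` norm) and has weak gradient `u`. -/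
def HasDirichletGradient {d : ℕ} {Λ : Domain d} {n : ℕ} (φ : L2 Λ n)
    (u : Fin n → Fin d → L2 Λ n) : Prop :=
  (φ, u) ∈ closure (testGraph Λ n)

/-- `φ` is in the form domain of the `n`-fermion Dirichlet Hamiltonian in `Λ` with one-particle
potential `V`, and has weak gradient `u`. -/
def InFormDomain {d : ℕ} {Λ : Domain d} {n : ℕ} (V : Space d → ℝ) (φ : L2 Λ n)
    (u : Fin n → Fin d → L2 Λ n) : Prop :=
  IsAntisymmetric φ ∧ HasDirichletGradient φ u ∧
    Integrable (fun x => (∑ i, V (x i)) * ‖φ x‖ ^ 2) (boxMeasure Λ n)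

/-- The graph of the `n`-fermion Dirichlet Hamiltonian
`H = ∑ i, (- Δ_i + V (x i))` on the antisymmetric part of `L²(Λ ^ n)`, for `V ≥ 0`: the operator
of the closed quadratic form
`q (φ, ψ) = ∑ i, ∫ ⟨∇_i φ, ∇_i ψ⟩ + ∫ (∑ i, V (x i)) * conj φ * ψ`. So `φ` is in the domain of
`H` and `H φ = f` when `φ` is in the form domain and `q (φ, ψ) = ⟨f, ψ⟩` for every `ψ` in the
form domain. -/
def hamiltonianGraph {d : ℕ} (V : Space d → ℝ) (Λ : Domain d) (n : ℕ) :
    Set (L2 Λ n × L2 Λ n) :=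
  {p | IsAntisymmetric p.2 ∧ ∃ u : Fin n → Fin d → L2 Λ n, InFormDomain V p.1 u ∧
    ∀ (ψ : L2 Λ n) (w : Fin n → Fin d → L2 Λ n), InFormDomain V ψ w →
      (∑ i, ∑ j, inner ℂ (u i j) (w i j)) +
        ∫ x, ((∑ i, V (x i) : ℝ) : ℂ) * (conj (p.1 x) * ψ x) ∂(boxMeasure Λ n) =
      inner ℂ p.2 ψ}

/-- The ground state energy: the infimum of `⟨H φ, φ⟩ / ‖φ‖²` over the nonzero `φ` in the domain
of `H`. It is `+∞` when there is no such `φ`. -/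
noncomputable def groundEnergy {d : ℕ} (V : Space d → ℝ) (Λ : Domain d) (n : ℕ) : EReal :=
  ⨅ p : {p : L2 Λ n × L2 Λ n // p ∈ hamiltonianGraph V Λ n ∧ p.1 ≠ 0},
    (((inner ℂ p.1.2 p.1.1).re / ‖p.1.1‖ ^ 2 : ℝ) : EReal)

/-! ## Noninteracting fermions on `ℤ ^ d` -/

/-- The lattice `ℤ ^ d`. -/
abbrev Lattice (d : ℕ) : Type := Fin d → ℤ

/-- A set of lattice sites, seen as the union of the unit cells of its sites. -/
def cells {d : ℕ} (Λ : Finset (Lattice d)) : Set (Space d) :=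
  {x | (fun j => ⌊x j⌋) ∈ Λ}

/-- The lattice vector that moves the `i`-th particle by one step in direction `j`. -/
def latticeStep {d n : ℕ} (i : Fin n) (j : Fin d) : Fin n → Lattice d :=
  Pi.single i (Pi.single j 1)

/-- The `n`-particle Hamiltonian `∑ i, (- Δ_i + V (x i))` with the discrete Laplacian
`(- Δ φ) (x) = ∑ (φ x - φ y)`, the sum over the nearest neighbours `y` of `x`. -/
noncomputable def latticeHamiltonian {d n : ℕ} (V : Lattice d → ℝ)
    (φ : (Fin n → Lattice d) → ℂ) (x : Fin n → Lattice d) : ℂ :=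
  ∑ i, ((∑ j, ((φ x - φ (x + latticeStep i j)) + (φ x - φ (x - latticeStep i j)))) +
    (V (x i) : ℂ) * φ x)

/-- The fermionic wave functions of `n` particles in `Λ`, extended by zero to the whole
lattice (Dirichlet condition). -/
def latticeFermions {d : ℕ} (Λ : Finset (Lattice d)) (n : ℕ) :
    Set ((Fin n → Lattice d) → ℂ) :=
  {φ | (∀ x, (∃ i, x i ∉ Λ) → φ x = 0) ∧
    ∀ (s : Equiv.Perm (Fin n)) (x : Fin n → Lattice d),
      φ (fun i => x (s i)) = (((Equiv.Perm.sign s : ℤ) : ℂ)) * φ x}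

/-- The ground state energy of `n` lattice fermions in `Λ`: the infimum of `⟨H φ, φ⟩ / ‖φ‖²` over
the nonzero fermionic wave functions in `Λ`, where `H` is the restriction of the Hamiltonian to
`ℓ²(Λ ^ n)`. It is `+∞` when there is no nonzero one, that is, when `n > |Λ|`. -/
noncomputable def latticeGroundEnergy {d : ℕ} (V : Lattice d → ℝ) (Λ : Finset (Lattice d))
    (n : ℕ) : EReal :=
  ⨅ φ : {φ : (Fin n → Lattice d) → ℂ // φ ∈ latticeFermions Λ n ∧ φ ≠ 0},
    (((∑ x ∈ Fintype.piFinset fun _ => Λ, conj (latticeHamiltonian V φ.1 x) * φ.1 x).re /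
      (∑ x ∈ Fintype.piFinset fun _ => Λ, ‖φ.1 x‖ ^ 2) : ℝ) : EReal)

end FermionGas

/-! Since the potential is nonnegative, the energy dominates the kinetic energy T, and a lower bound
on T comes from the Pauli principle. If φ is antisymmetric and E has finite measure, the normalised
indicator of E has occupation number at most 1 (`sum_exchange_le`). Indeed, let w₀ = 1_E(y) φ(x) and
let wᵢ be w₀ with y and xᵢ exchanged; by antisymmetry ‖w₀ - ∑ wᵢ‖² is n + 1 times the gap in the
desired inequality.

A wave function that varies little over a window is nearly constant there, so the window holds few
particles: by polarisation, the mass in the window is the occupation term plus half the squared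
increments (`window_le`). Averaging over all translates of a window B gives 2n|B|‖φ‖² ≤ 2|Λ|‖φ‖² +
|B| ∑ Dᵢ (`exclusion_principle`), where Dᵢ bounds the squared L² increment of φ when particle i
moves by an element of B - B. Only a measure invariant under translation and negation is needed, so
Lebesgue and counting measure are covered together.

For a cube of side l, Dᵢ is at most l²d times the kinetic energy of particle i. With l^d = 2|Λ|/n
the volume term absorbs half of the left side, leaving T ≥ n‖φ‖²/(d l²), of order
n(n/|Λ|)^(2/d)‖φ‖². On the lattice l is rounded up to an integer, at the cost of a factor 4.

These bounds are deterministic and hold for each finite domain of positive volume. The passage to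
the limit uses n/|Λ| → ρ and, for the energy density, the existence of one thermodynamic limit. -/

namespace FermionGas

/-! ## The exclusion principle on a product space -/

section Exclusion

/-- Exchange the position of the `i`-th particle with an additional point. -/
def exchange {X : Type*} {n : ℕ} (i : Fin n) (p : (Fin n → X) × X) : (Fin n → X) × X :=
  (Function.update p.1 i p.2, p.1 i)

theorem exchange_exchange {X : Type*} {n : ℕ} (i : Fin n) (p : (Fin n → X) × X) :
    exchange i (exchange i p) = p := by
  simp [exchange]

variable {X : Type*} [MeasurableSpace X] {n : ℕ}

/-- Splitting off the i-th coordinate as X × X^m turns the exchange into a swap of two factors of a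
product of copies of `μ`; the map is written as a composition of such rearrangements. -/
theorem measurePreserving_exchange (μ : Measure X) [SigmaFinite μ] (i : Fin n) :
    MeasurePreserving (exchange i) ((Measure.pi fun _ : Fin n => μ).prod μ)
      ((Measure.pi fun _ : Fin n => μ).prod μ) := by
  obtain ⟨m, rfl⟩ : ∃ m, n = m + 1 := Nat.exists_eq_succ_of_ne_zero (i.pos.ne')
  set ν := Measure.pi fun _ : Fin m => μ
  have he := measurePreserving_piFinSuccAbove (fun _ : Fin (m + 1) => μ) i
  have h1 := he.prod (MeasurePreserving.id μ)
  have h2 := (measurePreserving_prodAssoc μ ν μ)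
  have h3 : MeasurePreserving Prod.swap (μ.prod (ν.prod μ)) ((ν.prod μ).prod μ) :=
    Measure.measurePreserving_swap
  have h4 : MeasurePreserving (Prod.map Prod.swap id) ((ν.prod μ).prod μ) ((μ.prod ν).prod μ) :=
    Measure.measurePreserving_swap.prod (MeasurePreserving.id μ)
  have h5 := he.symm.prod (MeasurePreserving.id μ)
  have := h5.comp (h4.comp (h3.comp (h2.comp h1)))
  convert this using 1
  funext p
  simp [exchange, MeasurableEquiv.prodAssoc, MeasurableEquiv.piFinSuccAbove_symm_apply,
    MeasurableEquiv.piFinSuccAbove_apply, Fin.insertNthEquiv]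

/-- If `w₀, w₁, …, wₙ` have the same norm and `⟨wᵢ, wⱼ⟩ = - ⟨w₀, wⱼ⟩` for distinct `i, j ≥ 1`,
then `∑ ⟨w₀, wᵢ⟩ ≤ ‖w₀‖²`. -/
theorem sum_inner_le_norm_sq {H : Type*} [NormedAddCommGroup H] [InnerProductSpace ℝ H]
    (w₀ : H) (w : Fin n → H) (hn : ∀ i, ‖w i‖ = ‖w₀‖)
    (hw : ∀ i j, i ≠ j → inner ℝ (w i) (w j) = - inner ℝ w₀ (w j)) :
    ∑ i, inner ℝ w₀ (w i) ≤ ‖w₀‖ ^ 2 := by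
  -- The expansion of this square is (n + 1)(‖w₀‖² - ∑ ⟨w₀, wᵢ⟩).
  have h0 : 0 ≤ ‖w₀ - ∑ i, w i‖ ^ 2 := sq_nonneg _
  rw [norm_sub_sq_real, ← real_inner_self_eq_norm_sq (∑ i, w i), sum_inner, inner_sum] at h0
  have h1 : ∀ i, inner ℝ (w i) (∑ j, w j) =
      ‖w₀‖ ^ 2 + inner ℝ w₀ (w i) - ∑ j, inner ℝ w₀ (w j) := by
    intro i
    rw [inner_sum, ← Finset.add_sum_erase _ _ (Finset.mem_univ i),
      ← Finset.add_sum_erase (a := i) _ (fun j => inner ℝ w₀ (w j)) (Finset.mem_univ i),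
      real_inner_self_eq_norm_sq, hn,
      Finset.sum_congr rfl fun j hj => hw i j (Finset.ne_of_mem_erase hj).symm,
      Finset.sum_neg_distrib]
    ring
  simp only [h1, Finset.sum_sub_distrib, Finset.sum_add_distrib, Finset.sum_const,
    Finset.card_univ, Fintype.card_fin, nsmul_eq_mul] at h0
  have h2 : 0 ≤ (n + 1 : ℝ) * (‖w₀‖ ^ 2 - ∑ i, inner ℝ w₀ (w i)) := by linarith
  have h3 : (0 : ℝ) < n + 1 := by positivity
  linarith [(mul_nonneg_iff_of_pos_left h3).1 h2]

theorem inner_toLp {α : Type*} [MeasurableSpace α] {ν : Measure α} {u v : α → ℂ}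
    (hu : MemLp u 2 ν) (hv : MemLp v 2 ν) :
    inner ℝ (hu.toLp u) (hv.toLp v) = ∫ x, inner ℝ (u x) (v x) ∂ν := by
  rw [L2.inner_def]
  refine integral_congr_ae ?_
  filter_upwards [hu.coeFn_toLp, hv.coeFn_toLp] with x h1 h2
  rw [h1, h2]

theorem norm_sq_toLp {α : Type*} [MeasurableSpace α] {ν : Measure α} {u : α → ℂ}
    (hu : MemLp u 2 ν) :
    ENNReal.ofReal (‖hu.toLp u‖ ^ 2) = ∫⁻ x, ‖u x‖ₑ ^ 2 ∂ν := by
  rw [ENNReal.ofReal_pow (norm_nonneg _), ofReal_norm, Lp.enorm_toLp,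
    eLpNorm_eq_lintegral_rpow_enorm_toReal two_ne_zero ENNReal.ofNat_ne_top]
  rw [← ENNReal.rpow_natCast, ← ENNReal.rpow_mul]
  simp

/-- Exchange of two particles changes the sign of the wave function. -/
def IsAlternating (μ : Measure X) (φ : (Fin n → X) → ℂ) : Prop :=
  ∀ i j, i ≠ j → ∀ᵐ x ∂(Measure.pi fun _ : Fin n => μ), φ (x ∘ Equiv.swap i j) = - φ x

/-- At most one fermion occupies a given one-particle state, here the normalised indicator
function of a set. -/
theorem sum_exchange_le (μ : Measure X) [SigmaFinite μ] {φ : (Fin n → X) → ℂ}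
    (hm : Measurable φ) (hL : MemLp φ 2 (Measure.pi fun _ : Fin n => μ))
    (hφ : IsAlternating μ φ) {E : Set X} (hE : MeasurableSet E) (hE' : μ E ≠ ⊤) :
    ∃ h : MemLp (fun p : (Fin n → X) × X => E.indicator (fun _ => φ p.1) p.2) 2
        ((Measure.pi fun _ : Fin n => μ).prod μ),
      ∑ i, ∫ p, inner ℝ (E.indicator (fun _ => φ p.1) p.2)
        (E.indicator (fun _ => φ (exchange i p).1) (p.1 i))
          ∂((Measure.pi fun _ : Fin n => μ).prod μ) ≤ ‖h.toLp‖ ^ 2 ∧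
      ENNReal.ofReal (‖h.toLp‖ ^ 2) =
        μ E * ∫⁻ x, ‖φ x‖ₑ ^ 2 ∂(Measure.pi fun _ : Fin n => μ) := by
  set π := Measure.pi fun _ : Fin n => μ
  set w : (Fin n → X) × X → ℂ := fun p => E.indicator (fun _ => φ p.1) p.2 with hw
  have hwm : Measurable w := by
    have : w = (Prod.snd ⁻¹' E).indicator fun p => φ p.1 := by
      funext p
      by_cases hp : p.2 ∈ E <;> simp [hw, hp]
    rw [this]
    exact (hm.comp measurable_fst).indicator (measurable_snd hE)
  have hwI : ∫⁻ p, ‖w p‖ₑ ^ 2 ∂(π.prod μ) = μ E * ∫⁻ x, ‖φ x‖ₑ ^ 2 ∂π := by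
    rw [lintegral_prod _ (by fun_prop)]
    have : ∀ x, ∫⁻ y, ‖w (x, y)‖ₑ ^ 2 ∂μ = μ E * ‖φ x‖ₑ ^ 2 := by
      intro x
      have : (fun y => ‖w (x, y)‖ₑ ^ 2) = E.indicator fun _ => ‖φ x‖ₑ ^ 2 := by
        funext y
        by_cases hy : y ∈ E <;> simp [hw, hy]
      rw [this, lintegral_indicator hE, lintegral_const, Measure.restrict_apply_univ, mul_comm]
    simp only [this]
    rw [lintegral_const_mul _ (by fun_prop)]
  have hφI : ∫⁻ x, ‖φ x‖ₑ ^ 2 ∂π ≠ ⊤ := by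
    rw [← norm_sq_toLp hL]; exact ENNReal.ofReal_ne_top
  have hwL : MemLp w 2 (π.prod μ) := by
    refine ⟨hwm.aestronglyMeasurable, ?_⟩
    rw [eLpNorm_lt_top_iff_lintegral_rpow_enorm_lt_top two_ne_zero ENNReal.ofNat_ne_top]
    simp only [ENNReal.toReal_ofNat, ENNReal.rpow_ofNat]
    rw [hwI]
    exact ENNReal.mul_lt_top hE'.lt_top hφI.lt_top
  have hS := fun i : Fin n => measurePreserving_exchange μ i
  have hwi : ∀ i, MemLp (w ∘ exchange i) 2 (π.prod μ) := fun i => hwL.comp_measurePreserving (hS i)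
  -- Exchanging with i and then with j puts y at place i and the old xᵢ at place j; this is the
  -- configuration of `exchange j p` with particles i and j swapped.
  have hanti : ∀ i j, i ≠ j → ∀ᵐ p ∂(π.prod μ),
      φ (exchange j (exchange i p)).1 = - φ (exchange j p).1 := by
    intro i j hij
    have hq : Measure.QuasiMeasurePreserving (fun p => (exchange j p).1) (π.prod μ) π :=
      Measure.quasiMeasurePreserving_fst.comp (hS j).quasiMeasurePreserving
    filter_upwards [hq.ae (hφ i j hij)] with p hp
    rw [← hp]
    congr 1
    funext k
    simp only [exchange, Function.comp]
    rcases eq_or_ne k i with rfl | hki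
    · simp [hij]
    rcases eq_or_ne k j with rfl | hkj
    · simp [hij]
    · rw [Equiv.swap_apply_of_ne_of_ne hki hkj]
      simp [hki, hkj]
  refine ⟨hwL, ?_, by rw [norm_sq_toLp hwL, hwI]⟩
  have key := sum_inner_le_norm_sq (hwL.toLp w) (fun i => (hwi i).toLp _) ?_ ?_
  · simp only [inner_toLp] at key
    exact key
  · intro i
    rw [Lp.norm_toLp, Lp.norm_toLp, eLpNorm_comp_measurePreserving hwL.1 (hS i)]
  · intro i j hij
    simp only [inner_toLp]
    let e : (Fin n → X) × X ≃ᵐ (Fin n → X) × X :=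
      { toFun := exchange i
        invFun := exchange i
        left_inv := exchange_exchange i
        right_inv := exchange_exchange i
        measurable_toFun := (hS i).measurable
        measurable_invFun := (hS i).measurable }
    have he : MeasurePreserving e (π.prod μ) (π.prod μ) := hS i
    -- The change of variables `exchange i` turns ⟨wᵢ, wⱼ⟩ into the product of w₀ with wⱼ ∘
    -- `exchange i`, which is -wⱼ: the extra point is xⱼ in both cases, so the indicator is
    -- unaffected.
    rw [← he.integral_comp', ← integral_neg]
    refine integral_congr_ae ?_
    filter_upwards [hanti i j hij] with p hp
    have h1 : exchange i (e p) = p := exchange_exchange i p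
    have h2 : w (exchange j (e p)) = - w (exchange j p) := by
      have h3 : (exchange j (e p)).2 = (exchange j p).2 := by
        simp [e, exchange, hij.symm]
      simp only [hw]
      rw [h3]
      by_cases hy : (exchange j p).2 ∈ E
      · simp only [Set.indicator_of_mem hy]; exact hp
      · simp only [Set.indicator_of_notMem hy, neg_zero]
    simp only [Function.comp, h1, h2, inner_neg_right]

end Exclusion
end FermionGas

namespace FermionGas

/-! ### From occupation numbers to a volume bound by sliding windows -/

section Window

variable {X : Type*} [MeasurableSpace X] {n : ℕ}

/-- The exclusion principle for the particles in a window `G`. -/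
theorem window_le (μ : Measure X) [SigmaFinite μ] {φ : (Fin n → X) → ℂ}
    (hm : Measurable φ) (hL : MemLp φ 2 (Measure.pi fun _ : Fin n => μ))
    (hφ : IsAlternating μ φ) {Λ G : Set X} (hΛ : MeasurableSet Λ)
    (hsupp : ∀ x, (∃ i, x i ∉ Λ) → φ x = 0) (hG : MeasurableSet G) (hG' : μ G ≠ ⊤) :
    ∑ i, 2 * ∫⁻ p, {p : (Fin n → X) × X | p.2 ∈ G ∧ p.1 i ∈ G}.indicator
        (fun p => ‖φ p.1‖ₑ ^ 2) p ∂((Measure.pi fun _ : Fin n => μ).prod μ) ≤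
      2 * (μ (G ∩ Λ) * ∫⁻ x, ‖φ x‖ₑ ^ 2 ∂(Measure.pi fun _ : Fin n => μ)) +
      ∑ i, ∫⁻ p, {p : (Fin n → X) × X | p.2 ∈ G ∧ p.1 i ∈ G}.indicator
        (fun p => ‖φ p.1 - φ (exchange i p).1‖ₑ ^ 2) p
          ∂((Measure.pi fun _ : Fin n => μ).prod μ) := by
  set π := Measure.pi fun _ : Fin n => μ
  obtain ⟨hL1, hle, hnorm⟩ := sum_exchange_le μ hm hL hφ (hG.inter hΛ)
    (ne_top_of_le_ne_top hG' (measure_mono Set.inter_subset_left))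
  -- Used only for the square integrability of 1_G(y) φ(x).
  obtain ⟨hL2, -, -⟩ := sum_exchange_le μ hm hL hφ hG hG'
  have hS := fun i : Fin n => measurePreserving_exchange μ i
  set Q : Fin n → Set ((Fin n → X) × X) := fun i => {p | p.2 ∈ G ∧ p.1 i ∈ G} with hQ
  have hQm : ∀ i, MeasurableSet (Q i) := fun i =>
    (measurable_snd hG).inter (((measurable_pi_apply i).comp measurable_fst) hG)
  set u : Fin n → (Fin n → X) × X → ℂ := fun i => (Q i).indicator fun p => φ p.1 with hu
  have huL : ∀ i, MemLp (u i) 2 (π.prod μ) := by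
    intro i
    have h1 : u i = (Q i).indicator (fun p => G.indicator (fun _ => φ p.1) p.2) := by
      funext p
      by_cases hp : p ∈ Q i
      · simp only [hu, Set.indicator_of_mem hp, Set.indicator_of_mem (show p.2 ∈ G from hp.1)]
      · simp [hu, hp]
    rw [h1]
    exact hL2.indicator (hQm i)
  have hv : ∀ i p, u i (exchange i p) = (Q i).indicator (fun p => φ (exchange i p).1) p := by
    intro i p
    have : exchange i p ∈ Q i ↔ p ∈ Q i := by simp [hQ, exchange, and_comm]
    by_cases hp : p ∈ Q i
    · simp only [hu, Set.indicator_of_mem hp, Set.indicator_of_mem (this.2 hp)]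
    · simp only [hu, Set.indicator_of_notMem hp, Set.indicator_of_notMem (mt this.1 hp)]
  have hvL : ∀ i, MemLp (u i ∘ exchange i) 2 (π.prod μ) := fun i =>
    (huL i).comp_measurePreserving (hS i)
  -- Cutting down to Λ costs nothing in the product: if xᵢ ∉ Λ the factor φ(x) vanishes, and if y ∉
  -- Λ the exchanged factor does. Hence the volume term may use `G ∩ Λ`.
  have hin : ∀ i p, inner ℝ ((G ∩ Λ).indicator (fun _ => φ p.1) p.2)
      ((G ∩ Λ).indicator (fun _ => φ (exchange i p).1) (p.1 i)) =
      inner ℝ (u i p) (u i (exchange i p)) := by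
    intro i p
    rw [hv]
    by_cases hp : p ∈ Q i
    · have hp1 : p.2 ∈ G := hp.1
      have hp2 : p.1 i ∈ G := hp.2
      rw [Set.indicator_of_mem hp]
      simp only [hu, Set.indicator_of_mem hp]
      by_cases h1 : p.2 ∈ Λ
      · rw [Set.indicator_of_mem (Set.mem_inter hp1 h1)]
        by_cases h2 : p.1 i ∈ Λ
        · rw [Set.indicator_of_mem (Set.mem_inter hp2 h2)]
        · rw [hsupp p.1 ⟨i, h2⟩]; simp
      · rw [hsupp (exchange i p).1 ⟨i, by simpa [exchange] using h1⟩]; simp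
    · rw [Set.indicator_of_notMem hp]
      by_cases h1 : p.2 ∈ G
      · have h2 : p.1 i ∉ G := fun h => hp ⟨h1, h⟩
        rw [Set.indicator_of_notMem (fun h => h2 h.1) (fun _ => φ (exchange i p).1)]; simp
      · rw [Set.indicator_of_notMem (fun h => h1 h.1) (fun _ => φ p.1)]; simp [hu, hp]
  simp only [hin] at hle
  -- Polarisation for two vectors of equal norm, the exchange being an isometry.
  have hpol : ∀ i, 2 * ‖(huL i).toLp‖ ^ 2 =
      2 * (∫ p, inner ℝ (u i p) (u i (exchange i p)) ∂(π.prod μ)) +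
        ‖((huL i).sub (hvL i)).toLp‖ ^ 2 := by
    intro i
    have h1 : ‖(hvL i).toLp‖ = ‖(huL i).toLp‖ := by
      rw [Lp.norm_toLp, Lp.norm_toLp, eLpNorm_comp_measurePreserving (huL i).1 (hS i)]
    have h2 := inner_toLp (huL i) (hvL i)
    simp only [Function.comp] at h2
    rw [← h2, MemLp.toLp_sub (huL i) (hvL i), norm_sub_sq_real, h1]
    ring
  have e1 : ∀ i p, ‖u i p‖ₑ ^ 2 = (Q i).indicator (fun p => ‖φ p.1‖ₑ ^ 2) p := by
    intro i p
    by_cases hp : p ∈ Q i <;> simp [hu, hp]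
  have e2 : ∀ i p, ‖(u i - u i ∘ exchange i) p‖ₑ ^ 2 =
      (Q i).indicator (fun p => ‖φ p.1 - φ (exchange i p).1‖ₑ ^ 2) p := by
    intro i p
    simp only [Pi.sub_apply, Function.comp, hv]
    by_cases hp : p ∈ Q i <;> simp [hu, hp]
  obtain ⟨a, ha⟩ : ∃ a : Fin n → ℝ, ∀ i, a i = ‖(huL i).toLp‖ ^ 2 := ⟨_, fun _ => rfl⟩
  obtain ⟨b, hb⟩ : ∃ b : Fin n → ℝ, ∀ i, b i = ‖((huL i).sub (hvL i)).toLp‖ ^ 2 :=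
    ⟨_, fun _ => rfl⟩
  have ha0 : ∀ i, 0 ≤ a i := fun i => by rw [ha]; positivity
  have hb0 : ∀ i, 0 ≤ b i := fun i => by rw [hb]; positivity
  simp only [← ha, ← hb] at hpol
  have f1 : ∀ i, ∫⁻ p, (Q i).indicator (fun p => ‖φ p.1‖ₑ ^ 2) p ∂(π.prod μ) =
      ENNReal.ofReal (a i) := by
    intro i
    rw [ha, norm_sq_toLp (huL i)]
    exact lintegral_congr fun p => (e1 i p).symm
  have f2 : ∀ i, ∫⁻ p, (Q i).indicator (fun p => ‖φ p.1 - φ (exchange i p).1‖ₑ ^ 2) p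
      ∂(π.prod μ) = ENNReal.ofReal (b i) := by
    intro i
    rw [hb, norm_sq_toLp ((huL i).sub (hvL i))]
    exact lintegral_congr fun p => (e2 i p).symm
  rw [← hnorm]
  generalize ‖hL1.toLp‖ = c at hle ⊢
  change ∑ i, 2 * ∫⁻ p, (Q i).indicator (fun p => ‖φ p.1‖ₑ ^ 2) p ∂(π.prod μ) ≤
    2 * ENNReal.ofReal (c ^ 2) +
      ∑ i, ∫⁻ p, (Q i).indicator (fun p => ‖φ p.1 - φ (exchange i p).1‖ₑ ^ 2) p ∂(π.prod μ)
  simp only [f1, f2]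
  have f3 : ∀ r : ℝ, 2 * ENNReal.ofReal r = ENNReal.ofReal (2 * r) := fun r => by
    rw [ENNReal.ofReal_mul zero_le_two, ENNReal.ofReal_ofNat]
  simp only [f3]
  rw [← ENNReal.ofReal_sum_of_nonneg fun i _ => hb0 i,
    ← ENNReal.ofReal_add (by positivity) (Finset.sum_nonneg fun i _ => hb0 i), ← ENNReal.ofReal_sum_of_nonneg fun i _ => mul_nonneg zero_le_two (ha0 i)]
  refine ENNReal.ofReal_le_ofReal ?_
  simp only [hpol, Finset.sum_add_distrib, ← Finset.mul_sum]
  gcongr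

/-- Sliding the window over the whole space: a wave function that varies little when one particle
is moved by a difference of elements of `B` describes at most `|Λ| / |B|` fermions. -/
theorem exclusion_principle [AddCommGroup X] [MeasurableAdd₂ X] [MeasurableNeg X]
    (μ : Measure X) [SigmaFinite μ] [μ.IsAddLeftInvariant] [μ.IsNegInvariant]
    {φ : (Fin n → X) → ℂ}
    (hm : Measurable φ) (hL : MemLp φ 2 (Measure.pi fun _ : Fin n => μ))
    (hφ : IsAlternating μ φ) {Λ B : Set X} (hΛ : MeasurableSet Λ)
    (hsupp : ∀ x, (∃ i, x i ∉ Λ) → φ x = 0) (hB : MeasurableSet B) (hB' : μ B ≠ ⊤)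
    (hB0 : μ B ≠ 0) (D : Fin n → ENNReal)
    (hD : ∀ i, ∀ b ∈ B, ∀ b' ∈ B, ∫⁻ x, ‖φ x - φ (Function.update x i (x i + (b - b')))‖ₑ ^ 2
      ∂(Measure.pi fun _ : Fin n => μ) ≤ D i) :
    2 * n * μ B * ∫⁻ x, ‖φ x‖ₑ ^ 2 ∂(Measure.pi fun _ : Fin n => μ) ≤
      2 * μ Λ * ∫⁻ x, ‖φ x‖ₑ ^ 2 ∂(Measure.pi fun _ : Fin n => μ) + μ B * ∑ i, D i := by
  set π := Measure.pi fun _ : Fin n => μ with hπ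
  set N := ∫⁻ x, ‖φ x‖ₑ ^ 2 ∂π
  let G : X → Set X := fun a => {x | x - a ∈ B}
  have hsub : ∀ a, MeasurableSet (G a) := fun a => (measurable_id.sub_const a) hB
  have hGB : ∀ a, μ (G a) = μ B := fun a =>
    (measurePreserving_sub_right μ a).measure_preimage hB.nullMeasurableSet
  have key := lintegral_mono (μ := μ) fun a => window_le μ hm hL hφ hΛ hsupp (hsub a)
    (by rw [hGB]; exact hB')
  have hmeasS : ∀ i : Fin n, Measurable fun p : (Fin n → X) × X => (exchange i p).1 := fun i =>
    measurable_fst.comp (measurePreserving_exchange μ i).measurable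
  have hT : ∀ i : Fin n,
      MeasurableSet {q : X × ((Fin n → X) × X) | q.2.2 ∈ G q.1 ∧ q.2.1 i ∈ G q.1} := by
    intro i
    have m1 : Measurable fun q : X × ((Fin n → X) × X) => q.2.2 - q.1 := by fun_prop
    have m2 : Measurable fun q : X × ((Fin n → X) × X) => q.2.1 i - q.1 := by fun_prop
    exact (m1 hB).inter (m2 hB)
  -- Tonelli: averaging over the window position a replaces the indicator by the measure of the
  -- positions whose window contains both y and xᵢ.
  have hswap : ∀ (i : Fin n) (f : (Fin n → X) × X → ENNReal), Measurable f →
      (Measurable fun a => ∫⁻ p, {p : (Fin n → X) × X | p.2 ∈ G a ∧ p.1 i ∈ G a}.indicator f p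
        ∂(π.prod μ)) ∧
      ∫⁻ a, ∫⁻ p, {p : (Fin n → X) × X | p.2 ∈ G a ∧ p.1 i ∈ G a}.indicator f p
        ∂(π.prod μ) ∂μ = ∫⁻ x, ∫⁻ y, μ {a | y ∈ G a ∧ x i ∈ G a} * f (x, y) ∂μ ∂π := by
    intro i f hf
    have hF : Measurable fun q : X × ((Fin n → X) × X) =>
        {p : (Fin n → X) × X | p.2 ∈ G q.1 ∧ p.1 i ∈ G q.1}.indicator f q.2 :=
      (hf.comp measurable_snd).indicator (hT i)
    refine ⟨hF.lintegral_prod_right', ?_⟩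
    rw [lintegral_lintegral_swap hF.aemeasurable]
    have : ∀ p : (Fin n → X) × X,
        ∫⁻ a, {p : (Fin n → X) × X | p.2 ∈ G a ∧ p.1 i ∈ G a}.indicator f p ∂μ =
          μ {a | p.2 ∈ G a ∧ p.1 i ∈ G a} * f p := by
      intro p
      have h1 : MeasurableSet {a | p.2 ∈ G a ∧ p.1 i ∈ G a} :=
        measurable_prodMk_right (y := p) (hT i)
      have h2 : (fun a => {p : (Fin n → X) × X | p.2 ∈ G a ∧ p.1 i ∈ G a}.indicator f p) =
          {a | p.2 ∈ G a ∧ p.1 i ∈ G a}.indicator fun _ => f p := by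
        funext a
        by_cases h : p.2 ∈ G a ∧ p.1 i ∈ G a
        · rw [Set.indicator_of_mem (s := {a | p.2 ∈ G a ∧ p.1 i ∈ G a}) h,
            Set.indicator_of_mem (s := {p : (Fin n → X) × X | p.2 ∈ G a ∧ p.1 i ∈ G a}) h]
        · rw [Set.indicator_of_notMem (s := {a | p.2 ∈ G a ∧ p.1 i ∈ G a}) h,
            Set.indicator_of_notMem (s := {p : (Fin n → X) × X | p.2 ∈ G a ∧ p.1 i ∈ G a}) h]
      rw [h2, lintegral_indicator h1, lintegral_const, Measure.restrict_apply_univ, mul_comm]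
    simp only [this]
    rw [lintegral_prod]
    refine Measurable.aemeasurable (Measurable.mul ?_ hf)
    exact measurable_measure_prodMk_right (hT i)
  have hNm : Measurable fun p : (Fin n → X) × X => ‖φ p.1‖ₑ ^ 2 := by fun_prop
  have hDm : ∀ i, Measurable fun p : (Fin n → X) × X => ‖φ p.1 - φ (exchange i p).1‖ₑ ^ 2 :=
    fun i => ((hm.comp measurable_fst).sub (hm.comp (hmeasS i))).enorm.pow_const 2
  -- The autocorrelation of B: the weight of window positions containing two points that differ by
  -- h. Its total mass is `μ B * μ B`.
  set w : X → ENNReal := fun h => μ {b | b ∈ B ∧ b + h ∈ B} with hw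
  have hwT : MeasurableSet {q : X × X | q.2 ∈ B ∧ q.2 + q.1 ∈ B} :=
    (measurable_snd hB).inter ((measurable_snd.add measurable_fst) hB)
  have hwm : Measurable w := measurable_measure_prodMk_left hwT
  have hw1 : ∫⁻ h, w h ∂μ = μ B * μ B := by
    have h1 : ∀ h, w h = ∫⁻ b, {q : X × X | q.2 ∈ B ∧ q.2 + q.1 ∈ B}.indicator 1 (h, b) ∂μ := by
      intro h
      exact (lintegral_indicator_one (measurable_prodMk_left (x := h) hwT)).symm
    simp only [h1]
    rw [lintegral_lintegral_swap
      (f := fun h b => {q : X × X | q.2 ∈ B ∧ q.2 + q.1 ∈ B}.indicator 1 (h, b))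
      (measurable_one.indicator hwT).aemeasurable]
    have h2 : ∀ b, ∫⁻ h, {q : X × X | q.2 ∈ B ∧ q.2 + q.1 ∈ B}.indicator 1 (h, b) ∂μ =
        B.indicator (fun _ => μ B) b := by
      intro b
      by_cases hb : b ∈ B
      · rw [Set.indicator_of_mem hb,
          ← (measurePreserving_add_left μ b).measure_preimage hB.nullMeasurableSet,
          ← lintegral_indicator_one (measurable_const_add b hB)]
        refine lintegral_congr fun h => ?_
        by_cases hh : b + h ∈ B <;> simp [hb, hh]
      · simp [hb]
    simp only [h2]
    rw [lintegral_indicator hB, lintegral_const, Measure.restrict_apply_univ]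
  have hw2 : ∀ x h, μ {a | x + h ∈ G a ∧ x ∈ G a} = w h := by
    intro x h
    refine Eq.trans ?_ ((Measure.measurePreserving_sub_left μ x).measure_preimage
      (MeasurableSet.nullMeasurableSet (measurable_prodMk_left (x := h) hwT)))
    congr 1
    ext a
    simp only [G, Set.mem_ofPred_eq, Set.mem_preimage, sub_add_eq_add_sub]
    exact and_comm
  -- A nonzero weight forces h ∈ B - B, the only displacements for which `hD` gives a bound.
  have hw3 : ∀ (i : Fin n) (h : X), w h *
      ∫⁻ x, ‖φ x - φ (Function.update x i (x i + h))‖ₑ ^ 2 ∂π ≤ w h * D i := by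
    intro i h
    by_cases h0 : w h = 0
    · simp [h0]
    · obtain ⟨b, hb, hb'⟩ := nonempty_of_measure_ne_zero h0
      have := hD i _ hb' b hb
      rw [add_sub_cancel_left] at this
      gcongr
  have hGΛ : ∫⁻ a, μ (G a ∩ Λ) ∂μ = μ B * μ Λ := by
    have hR : MeasurableSet {q : X × X | q.2 - q.1 ∈ B ∧ q.2 ∈ Λ} :=
      ((measurable_snd.sub measurable_fst) hB).inter (measurable_snd hΛ)
    have h1 : ∀ a, μ (G a ∩ Λ) =
        ∫⁻ x, {q : X × X | q.2 - q.1 ∈ B ∧ q.2 ∈ Λ}.indicator 1 (a, x) ∂μ := by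
      intro a
      exact (lintegral_indicator_one ((hsub a).inter hΛ)).symm
    simp only [h1]
    rw [lintegral_lintegral_swap
      (f := fun a x => {q : X × X | q.2 - q.1 ∈ B ∧ q.2 ∈ Λ}.indicator 1 (a, x))
      (measurable_one.indicator hR).aemeasurable]
    have h2 : ∀ x, ∫⁻ a, {q : X × X | q.2 - q.1 ∈ B ∧ q.2 ∈ Λ}.indicator 1 (a, x) ∂μ =
        Λ.indicator (fun _ => μ B) x := by
      intro x
      by_cases hx : x ∈ Λ
      · rw [Set.indicator_of_mem hx,
          ← (Measure.measurePreserving_sub_left μ x).measure_preimage hB.nullMeasurableSet,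
          ← lintegral_indicator_one ((Measure.measurePreserving_sub_left μ x).measurable hB)]
        refine lintegral_congr fun a => ?_
        by_cases ha : x - a ∈ B <;> simp [hx, ha]
      · simp [hx]
    simp only [h2]
    rw [lintegral_indicator hΛ, lintegral_const, Measure.restrict_apply_univ]
  have hleft : ∀ i : Fin n, ∫⁻ x, ∫⁻ y, μ {a | y ∈ G a ∧ x i ∈ G a} * ‖φ x‖ₑ ^ 2 ∂μ ∂π =
      μ B * μ B * N := by
    intro i
    rw [← lintegral_const_mul _ (by fun_prop)]
    refine lintegral_congr fun x => ?_
    rw [← lintegral_add_left_eq_self _ (x i)]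
    simp only [hw2]
    rw [lintegral_mul_const _ hwm, hw1]
  have hright : ∀ i : Fin n, ∫⁻ x, ∫⁻ y, μ {a | y ∈ G a ∧ x i ∈ G a} *
      ‖φ x - φ (exchange i (x, y)).1‖ₑ ^ 2 ∂μ ∂π ≤ μ B * μ B * D i := by
    intro i
    have h1 : ∀ x : Fin n → X, ∫⁻ y, μ {a | y ∈ G a ∧ x i ∈ G a} *
        ‖φ x - φ (exchange i (x, y)).1‖ₑ ^ 2 ∂μ =
        ∫⁻ h, w h * ‖φ x - φ (Function.update x i (x i + h))‖ₑ ^ 2 ∂μ := by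
      intro x
      rw [← lintegral_add_left_eq_self _ (x i)]
      simp only [hw2, exchange]
    simp only [h1]
    have hup : Measurable fun q : (Fin n → X) × X => Function.update q.1 i (q.1 i + q.2) := by
      have : Measurable fun q : (Fin n → X) × X => (q.1, q.1 i + q.2) := by fun_prop
      exact (hmeasS i).comp this
    have hdm : Measurable fun q : (Fin n → X) × X =>
        ‖φ q.1 - φ (Function.update q.1 i (q.1 i + q.2))‖ₑ ^ 2 :=
      ((hm.comp measurable_fst).sub (hm.comp hup)).enorm.pow_const 2
    rw [lintegral_lintegral_swap ((hwm.comp measurable_snd).mul hdm).aemeasurable]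
    rw [← hw1, ← lintegral_mul_const _ hwm]
    refine lintegral_mono fun h => ?_
    exact (lintegral_const_mul _ (hdm.comp (measurable_prodMk_right (y := h)))).trans_le (hw3 i h)
  have e1 : ∫⁻ a, ∑ i : Fin n, 2 * ∫⁻ p, {p : (Fin n → X) × X | p.2 ∈ G a ∧ p.1 i ∈ G a}.indicator
      (fun p => ‖φ p.1‖ₑ ^ 2) p ∂(π.prod μ) ∂μ = n * (2 * (μ B * μ B * N)) := by
    rw [lintegral_finsetSum _ fun i _ => (hswap i _ hNm).1.const_mul 2]
    simp only [lintegral_const_mul _ (hswap _ _ hNm).1, (hswap _ _ hNm).2, hleft]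
    simp
  have e2 : ∫⁻ a, (2 * (μ (G a ∩ Λ) * N) +
      ∑ i : Fin n, ∫⁻ p, {p : (Fin n → X) × X | p.2 ∈ G a ∧ p.1 i ∈ G a}.indicator
        (fun p => ‖φ p.1 - φ (exchange i p).1‖ₑ ^ 2) p ∂(π.prod μ)) ∂μ ≤
      2 * (μ B * μ Λ * N) + ∑ i, μ B * μ B * D i := by
    rw [lintegral_add_right _ (Finset.measurable_fun_sum _ fun i _ => (hswap i _ (hDm i)).1),
      lintegral_finsetSum _ fun i _ => (hswap i _ (hDm i)).1]
    have hNt : N ≠ ⊤ := (norm_sq_toLp hL).symm.trans_ne ENNReal.ofReal_ne_top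
    rw [lintegral_const_mul' _ _ ENNReal.ofNat_ne_top, lintegral_mul_const' _ _ hNt, hGΛ]
    gcongr with i
    rw [(hswap i _ (hDm i)).2]
    exact hright i
  have hfin := (e1.symm.le.trans key).trans e2
  rw [← Finset.mul_sum] at hfin
  rw [← ENNReal.mul_le_mul_iff_right hB0 hB']
  calc μ B * (2 * n * μ B * N) = n * (2 * (μ B * μ B * N)) := by ring
    _ ≤ _ := hfin
    _ = _ := by ring

end Window
end FermionGas

namespace FermionGas

/-! ### L² increments and the Dirichlet gradient -/

section Translation

theorem eLpNorm_two_sq {α F : Type*} [MeasurableSpace α] [NormedAddCommGroup F] (f : α → F)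
    (ν : Measure α) : eLpNorm f 2 ν ^ 2 = ∫⁻ x, ‖f x‖ₑ ^ 2 ∂ν := by
  rw [eLpNorm_eq_lintegral_rpow_enorm_toReal two_ne_zero ENNReal.ofNat_ne_top,
    ← ENNReal.rpow_natCast, ← ENNReal.rpow_mul]
  simp

/-- The `L²` modulus of continuity of a smooth function is controlled by its derivative. -/
theorem eLpNorm_sub_translate_le {E : Type*} [NormedAddCommGroup E] [NormedSpace ℝ E]
    [MeasurableSpace E] [BorelSpace E] [SecondCountableTopology E] (μ : Measure E) [SFinite μ]
    [μ.IsAddRightInvariant] {g : E → ℂ} (hg : ContDiff ℝ 1 g) (v : E) :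
    eLpNorm (fun x => g x - g (x + v)) 2 μ ≤ eLpNorm (fun x => fderiv ℝ g x v) 2 μ := by
  rw [← ENNReal.pow_le_pow_left_iff two_ne_zero, eLpNorm_two_sq, eLpNorm_two_sq]
  have hc : Continuous fun x => fderiv ℝ g x v := (hg.continuous_fderiv one_ne_zero).clm_apply
    continuous_const
  set ν : Measure ℝ := volume.restrict (Set.Ioc 0 1) with hν
  have : IsProbabilityMeasure ν := ⟨by simp [hν]⟩
  -- The increment is the integral of the derivative along the segment; on the unit interval, a
  -- probability space, the L¹ norm is at most the L² norm.
  have hpt : ∀ x, ‖g x - g (x + v)‖ₑ ^ 2 ≤ ∫⁻ t, ‖fderiv ℝ g (x + t • v) v‖ₑ ^ 2 ∂ν := by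
    intro x
    have hcx : Continuous fun t : ℝ => fderiv ℝ g (x + t • v) v := hc.comp (by fun_prop)
    have hd : ∀ t : ℝ, HasDerivAt (fun t : ℝ => g (x + t • v)) (fderiv ℝ g (x + t • v) v) t := by
      intro t
      have h1 : HasDerivAt (fun t : ℝ => x + t • v) v t := by
        simpa using ((hasDerivAt_id t).smul_const v).const_add x
      exact ((hg.differentiable one_ne_zero (x + t • v)).hasFDerivAt).comp_hasDerivAt t h1
    have hft := intervalIntegral.integral_eq_sub_of_hasDerivAt (a := 0) (b := 1)
      (fun t _ => hd t) (hcx.intervalIntegrable _ _)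
    simp only [zero_smul, add_zero, one_smul] at hft
    rw [intervalIntegral.integral_of_le zero_le_one] at hft
    rw [← eLpNorm_two_sq]
    gcongr
    rw [← enorm_neg, neg_sub, ← hft]
    refine (enorm_integral_le_lintegral_enorm _).trans ?_
    rw [← eLpNorm_one_eq_lintegral_enorm]
    exact eLpNorm_le_eLpNorm_of_exponent_le one_le_two hcx.aestronglyMeasurable
  refine (lintegral_mono hpt).trans ?_
  have hm : Measurable fun q : E × ℝ => ‖fderiv ℝ g (q.1 + q.2 • v) v‖ₑ ^ 2 := by
    have : Continuous fun q : E × ℝ => fderiv ℝ g (q.1 + q.2 • v) v := hc.comp (by fun_prop)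
    exact this.measurable.enorm.pow_const 2
  rw [lintegral_lintegral_swap hm.aemeasurable]
  simp only [lintegral_add_right_eq_self (fun x => ‖fderiv ℝ g x v‖ₑ ^ 2)]
  simp

variable {d n : ℕ}

theorem measurableSet_boxPow (Λ : Domain d) (n : ℕ) : MeasurableSet (boxPow Λ n) :=
  MeasurableSet.univ_pi fun _ => Λ.isOpen.measurableSet

theorem eLpNorm_of_support_subset (Λ : Domain d) {f : Config d n → ℂ}
    (hf : ∀ x ∉ boxPow Λ n, f x = 0) : eLpNorm f 2 volume = eLpNorm f 2 (boxMeasure Λ n) := by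
  have : f = (boxPow Λ n).indicator f := by
    funext x
    by_cases hx : x ∈ boxPow Λ n
    · rw [Set.indicator_of_mem hx]
    · rw [Set.indicator_of_notMem hx, hf x hx]
  conv_lhs => rw [this]
  exact eLpNorm_indicator_eq_eLpNorm_restrict (measurableSet_boxPow Λ n)

/-- Extension by zero of a function on `Λ ^ n`. -/
noncomputable def extend {Λ : Domain d} (φ : L2 Λ n) : Config d n → ℂ := (boxPow Λ n).indicator φ

theorem fderiv_single {g : Config d n → ℂ} (x : Config d n) (i : Fin n) (h : Space d) :
    fderiv ℝ g x (Pi.single i h) =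
      ∑ j, (h j) • fderiv ℝ g x (Pi.single i (EuclideanSpace.single j 1)) := by
  have h1 : h = ∑ j, h j • EuclideanSpace.single j (1 : ℝ) := by
    ext k
    simp [Finset.sum_apply, Pi.single_apply]
  have h2 := congrArg (LinearMap.single ℝ (fun _ : Fin n => Space d) i) h1
  simp only [map_sum, map_smul, LinearMap.coe_single] at h2
  rw [h2]
  simp only [map_sum, map_smul]

/-- Minkowski's inequality for the directional derivative ∑ hⱼ ∂ⱼg. The derivatives vanish outside
Λ^n, so their norms on the whole space are the norms in `L2 Λ n`. -/
theorem eLpNorm_sub_translate_test_le {Λ : Domain d} {g : Config d n → ℂ}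
    (hg : ContDiff ℝ (⊤ : ℕ∞) g) (hsupp : tsupport g ⊆ boxPow Λ n) {u : Fin n → Fin d → L2 Λ n}
    (hu : ∀ i j, u i j =ᵐ[boxMeasure Λ n]
      fun x => fderiv ℝ g x (Pi.single i (EuclideanSpace.single j 1))) (i : Fin n) (h : Space d) :
    eLpNorm (fun x => g x - g (x + Pi.single i h)) 2 volume ≤
      ENNReal.ofReal (∑ j, |h j| * ‖u i j‖) := by
  have hg1 : ContDiff ℝ 1 g := hg.of_le (by exact_mod_cast le_top)
  refine (eLpNorm_sub_translate_le volume hg1 _).trans ?_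
  have hc : ∀ j, Continuous fun x => fderiv ℝ g x (Pi.single i (EuclideanSpace.single j (1 : ℝ))) :=
    fun j => (hg1.continuous_fderiv one_ne_zero).clm_apply continuous_const
  have h1 : (fun x => fderiv ℝ g x (Pi.single i h)) =
      ∑ j, (h j) • fun x => fderiv ℝ g x (Pi.single i (EuclideanSpace.single j 1)) := by
    funext x
    rw [fderiv_single, Finset.sum_apply]
    rfl
  rw [h1, ENNReal.ofReal_sum_of_nonneg fun j _ => by positivity]
  refine (eLpNorm_sum_le (fun j _ => ((hc j).aestronglyMeasurable.const_smul _)) one_le_two).trans ?_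
  gcongr with j
  rw [eLpNorm_const_smul, eLpNorm_of_support_subset Λ, ← eLpNorm_congr_ae (hu i j),
    ENNReal.ofReal_mul (abs_nonneg _), Lp.norm_def, ENNReal.ofReal_toReal (Lp.eLpNorm_ne_top _),
    Real.enorm_eq_ofReal_abs]
  intro x hx
  have : fderiv ℝ g x = 0 := by
    have h2 : x ∉ tsupport (fderiv ℝ g) := fun h3 => hx (hsupp (tsupport_fderiv_subset ℝ h3))
    exact image_eq_zero_of_notMem_tsupport h2
  rw [this]; rfl

theorem eLpNorm_sub_translate_extend_le {Λ : Domain d} {φ : L2 Λ n} {u : Fin n → Fin d → L2 Λ n}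
    (hφ : HasDirichletGradient φ u) (i : Fin n) (h : Space d) :
    eLpNorm (fun x => extend φ x - extend φ (x + Pi.single i h)) 2 volume ≤
      ENNReal.ofReal (∑ j, |h j| * ‖u i j‖) := by
  -- Approximation by a test function costs δ for φ, δ for its translate and δ in each partial
  -- derivative; then δ → 0.
  have key : ∀ δ : ℝ, 0 < δ → eLpNorm (fun x => extend φ x - extend φ (x + Pi.single i h)) 2 volume ≤
      ENNReal.ofReal (δ + (∑ j, |h j| * (‖u i j‖ + δ)) + δ) := by
    intro δ hδ
    obtain ⟨⟨φ₀, u₀⟩, ⟨g, hg, -, hsupp, hφ₀, hu₀⟩, hdist⟩ := Metric.mem_closure_iff.1 hφ δ hδ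
    rw [Prod.dist_eq, max_lt_iff] at hdist
    obtain ⟨hd1, hd2⟩ := hdist
    have hd3 : ∀ j, ‖u₀ i j‖ ≤ ‖u i j‖ + δ := by
      intro j
      have h1 : dist (u i j) (u₀ i j) ≤ δ :=
        ((dist_le_pi_dist (u i) (u₀ i) j).trans (dist_le_pi_dist u u₀ i)).trans hd2.le
      rw [dist_comm, dist_eq_norm] at h1
      linarith [norm_le_norm_add_norm_sub' (u₀ i j) (u i j)]
    have hgm : AEStronglyMeasurable g volume := hg.continuous.aestronglyMeasurable
    have hφm : AEStronglyMeasurable (extend φ) volume :=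
      (aestronglyMeasurable_indicator_iff (measurableSet_boxPow Λ n)).2 (Lp.aestronglyMeasurable φ)
    have hclose : eLpNorm (fun x => extend φ x - g x) 2 volume ≤ ENNReal.ofReal δ := by
      rw [eLpNorm_of_support_subset Λ]
      · have : (fun x => extend φ x - g x) =ᵐ[boxMeasure Λ n] ⇑(φ - φ₀) := by
          filter_upwards [hφ₀, Lp.coeFn_sub φ φ₀,
            ae_restrict_mem (measurableSet_boxPow Λ n)] with x h1 h2 h3
          rw [h2, Pi.sub_apply, h1, extend, Set.indicator_of_mem h3]
        rw [eLpNorm_congr_ae this, ← Lp.enorm_def, ← ofReal_norm, ← dist_eq_norm]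
        exact ENNReal.ofReal_le_ofReal hd1.le
      · intro x hx
        rw [extend, Set.indicator_of_notMem hx,
          image_eq_zero_of_notMem_tsupport fun h3 => hx (hsupp h3), sub_zero]
    have hmp := measurePreserving_add_right (volume : Measure (Config d n)) (Pi.single i h : Config d n)
    have hclose' : eLpNorm (fun x : Config d n => g (x + Pi.single i h) - extend φ (x + Pi.single i h)) 2 volume ≤
        ENNReal.ofReal δ := by
      have h1 := eLpNorm_comp_measurePreserving (p := 2) (hφm.sub hgm) hmp
      rw [← eLpNorm_neg]
      refine le_trans (le_of_eq ?_) (h1.trans_le hclose)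
      congr 1
      funext x
      simp
    have hsplit : (fun x => extend φ x - extend φ (x + Pi.single i h)) =
        ((fun x => extend φ x - g x) + fun x => g x - g (x + Pi.single i h)) +
          fun x : Config d n => g (x + Pi.single i h) - extend φ (x + Pi.single i h) := by
      funext x
      simp
    have hgm' : AEStronglyMeasurable (fun x : Config d n => g (x + Pi.single i h)) volume :=
      hgm.comp_measurePreserving hmp
    have hφm' : AEStronglyMeasurable (fun x : Config d n => extend φ (x + Pi.single i h)) volume :=
      hφm.comp_measurePreserving hmp
    rw [hsplit, ENNReal.ofReal_add (by positivity) hδ.le, ENNReal.ofReal_add hδ.le (by positivity)]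
    refine (eLpNorm_add_le ((hφm.sub hgm).add (hgm.sub hgm')) (hgm'.sub hφm') one_le_two).trans ?_
    refine add_le_add ((eLpNorm_add_le (hφm.sub hgm) (hgm.sub hgm') one_le_two).trans
      (add_le_add hclose ?_)) hclose'
    refine (eLpNorm_sub_translate_test_le hg hsupp hu₀ i h).trans (ENNReal.ofReal_le_ofReal ?_)
    gcongr with j
    exact hd3 j
  have hlim : Tendsto (fun δ : ℝ => ENNReal.ofReal (δ + (∑ j, |h j| * (‖u i j‖ + δ)) + δ)) (𝓝[>] 0)
      (𝓝 (ENNReal.ofReal (∑ j, |h j| * ‖u i j‖))) := by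
    have hcont : Continuous fun δ : ℝ =>
        ENNReal.ofReal (δ + (∑ j, |h j| * (‖u i j‖ + δ)) + δ) :=
      ENNReal.continuous_ofReal.comp (by fun_prop)
    have := hcont.tendsto 0
    simp only [zero_add, add_zero] at this
    exact this.mono_left nhdsWithin_le_nhds
  refine ge_of_tendsto hlim ?_
  filter_upwards [self_mem_nhdsWithin] with δ hδ using key δ hδ

end Translation
end FermionGas

namespace FermionGas

/-! ### The energy bound in the continuum -/

section Continuum

variable {d n : ℕ}

theorem volume_box (s : Fin d → Set ℝ) :
    volume {x : Space d | ∀ j, x j ∈ s j} = ∏ j, volume (s j) := by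
  rw [← volume_pi_pi, ← (PiLp.volume_preserving_ofLp (Fin d)).measure_preimage_equiv
    (f := (MeasurableEquiv.toLp 2 (Fin d → ℝ)).symm)]
  congr 1
  ext x
  simp

theorem measurableSet_box {s : Fin d → Set ℝ} (hs : ∀ j, MeasurableSet (s j)) :
    MeasurableSet {x : Space d | ∀ j, x j ∈ s j} := by
  have : {x : Space d | ∀ j, x j ∈ s j} = ⋂ j, (fun x : Space d => x j) ⁻¹' s j := by
    ext x; simp
  rw [this]
  exact MeasurableSet.iInter fun j => (by fun_prop : Measurable fun x : Space d => x j) (hs j)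

theorem isAlternating_extend {Λ : Domain d} {φ : L2 Λ n} (hφ : IsAntisymmetric φ) :
    IsAlternating volume (extend φ) := by
  intro i j hij
  rw [← volume_pi]
  have h1 := (ae_restrict_iff' (measurableSet_boxPow Λ n)).1 (hφ (Equiv.swap i j))
  filter_upwards [h1] with x hx
  have hmem : x ∘ Equiv.swap i j ∈ boxPow Λ n ↔ x ∈ boxPow Λ n := by
    simp only [boxPow, Set.mem_univ_pi, Function.comp]
    exact (Equiv.swap i j).forall_congr_right (q := fun k => x k ∈ Λ.carrier)
  by_cases hb : x ∈ boxPow Λ n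
  · rw [extend, Set.indicator_of_mem hb, Set.indicator_of_mem (hmem.2 hb)]
    have := hx hb
    rw [Equiv.Perm.sign_swap hij] at this
    rw [Units.val_neg, Units.val_one, Int.cast_neg, Int.cast_one, neg_one_mul] at this
    exact this
  · rw [extend, Set.indicator_of_notMem hb, Set.indicator_of_notMem (mt hmem.1 hb), neg_zero]

theorem eLpNorm_extend {Λ : Domain d} (φ : L2 Λ n) :
    eLpNorm (extend φ) 2 volume = ENNReal.ofReal ‖φ‖ := by
  rw [extend, eLpNorm_indicator_eq_eLpNorm_restrict (measurableSet_boxPow Λ n), Lp.norm_def,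
    ENNReal.ofReal_toReal (Lp.eLpNorm_ne_top _)]
  rfl

theorem measurable_extend {Λ : Domain d} (φ : L2 Λ n) : Measurable (extend φ) :=
  (Lp.stronglyMeasurable φ).measurable.indicator (measurableSet_boxPow Λ n)

/-- Cauchy–Schwarz over the d directions; this is the source of the 1/d in `energyConst`. -/
theorem sq_sum_abs_mul_le {h a : Fin d → ℝ} {l : ℝ} (hl : ∀ j, |h j| ≤ l) (ha : ∀ j, 0 ≤ a j) :
    (∑ j, |h j| * a j) ^ 2 ≤ l ^ 2 * d * ∑ j, a j ^ 2 := by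
  calc (∑ j, |h j| * a j) ^ 2 ≤ (∑ j, l * a j) ^ 2 := by
        refine pow_le_pow_left₀ (Finset.sum_nonneg fun j _ => mul_nonneg (abs_nonneg _) (ha j))
          (Finset.sum_le_sum fun j _ => mul_le_mul_of_nonneg_right (hl j) (ha j)) 2
    _ = l ^ 2 * (∑ j, a j) ^ 2 := by rw [← Finset.mul_sum]; ring
    _ ≤ l ^ 2 * (d * ∑ j, a j ^ 2) := by
        gcongr
        simpa using sq_sum_le_card_mul_sum_sq (s := Finset.univ) (f := a)
    _ = _ := by ring

theorem le_of_ennreal_le {a v q s : ℝ} (ha : 0 ≤ a) (hv : 0 ≤ v) (hq : 0 ≤ q) (hs : 0 ≤ s)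
    (h : 2 * n * ENNReal.ofReal a * ENNReal.ofReal q ≤
      2 * ENNReal.ofReal v * ENNReal.ofReal q + ENNReal.ofReal a * ENNReal.ofReal s) :
    2 * n * a * q ≤ 2 * v * q + a * s := by
  rw [← ENNReal.ofReal_ofNat 2, ← ENNReal.ofReal_natCast n,
    ← ENNReal.ofReal_mul (by positivity), ← ENNReal.ofReal_mul (by positivity),
    ← ENNReal.ofReal_mul (by positivity), ← ENNReal.ofReal_mul (by positivity),
    ← ENNReal.ofReal_mul (by positivity), ← ENNReal.ofReal_mul (by positivity),
    ← ENNReal.ofReal_add (by positivity) (by positivity),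
    ENNReal.ofReal_le_ofReal_iff (by positivity)] at h
  exact h

theorem volume_ne_top (Λ : Domain d) : volume Λ.carrier ≠ ⊤ :=
  Λ.isBounded.measure_lt_top.ne

/-- The kinetic energy of `n` fermions in `Λ`, at the length scale `l`. -/
theorem kinetic_energy_ge_of_scale {Λ : Domain d} {φ : L2 Λ n} {u : Fin n → Fin d → L2 Λ n}
    (ha : IsAntisymmetric φ) (hu : HasDirichletGradient φ u) {l : ℝ} (hl : 0 < l) :
    2 * n * l ^ d * ‖φ‖ ^ 2 ≤ 2 * (volume Λ.carrier).toReal * ‖φ‖ ^ 2 +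
      l ^ d * ∑ i, l ^ 2 * d * ∑ j, ‖u i j‖ ^ 2 := by
  have hvB : volume {x : Space d | ∀ j, x j ∈ Set.Ico 0 l} = ENNReal.ofReal (l ^ d) := by
    rw [volume_box]
    simp [Real.volume_Ico, ENNReal.ofReal_pow hl.le]
  have key := exclusion_principle (volume : Measure (Space d)) (measurable_extend φ)
    (Λ := Λ.carrier) (B := {x : Space d | ∀ j, x j ∈ Set.Ico 0 l})
    ⟨(measurable_extend φ).aestronglyMeasurable, by
      rw [← volume_pi, eLpNorm_extend]; exact ENNReal.ofReal_lt_top⟩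
    (isAlternating_extend ha) Λ.isOpen.measurableSet
    (fun x ⟨i, hi⟩ => Set.indicator_of_notMem (fun h : x ∈ boxPow Λ n => hi (h i trivial)) _)
    (measurableSet_box fun _ => measurableSet_Ico) (by rw [hvB]; exact ENNReal.ofReal_ne_top)
    (by rw [hvB]; simpa using pow_pos hl d)
    (fun i => ENNReal.ofReal (l ^ 2 * d * ∑ j, ‖u i j‖ ^ 2)) ?_
  · rw [hvB, ← volume_pi, ← eLpNorm_two_sq, eLpNorm_extend, ← ENNReal.ofReal_pow (norm_nonneg _),
      ← ENNReal.ofReal_toReal (volume_ne_top Λ),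
      ← ENNReal.ofReal_sum_of_nonneg fun i _ => by positivity] at key
    exact le_of_ennreal_le (pow_nonneg hl.le d) ENNReal.toReal_nonneg (sq_nonneg _) (by positivity) key
  · intro i b hb b' hb'
    rw [← volume_pi, ← eLpNorm_two_sq]
    have h1 : ∀ x : Config d n, Function.update x i (x i + (b - b')) = x + Pi.single i (b - b') := by
      intro x
      funext k
      rcases eq_or_ne k i with rfl | hk
      · simp
      · simp [hk]
    simp only [h1]
    refine (pow_le_pow_left' (eLpNorm_sub_translate_extend_le hu i (b - b')) 2).trans ?_
    rw [← ENNReal.ofReal_pow (by positivity)]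
    refine ENNReal.ofReal_le_ofReal (sq_sum_abs_mul_le (fun j => ?_) fun j => norm_nonneg _)
    have h2 := hb j
    have h3 := hb' j
    rw [PiLp.sub_apply, abs_le]
    constructor <;> linarith [h2.1, h2.2, h3.1, h3.2]

/-- The constant in the lower bound on the energy per particle. -/
noncomputable def energyConst (d : ℕ) : ℝ := 1 / (4 * d) * (1 / 2) ^ (2 / (d : ℝ))

theorem energyConst_pos (hd : 0 < d) : 0 < energyConst d := by
  unfold energyConst; positivity

theorem kinetic_energy_ge (hd : 0 < d) {Λ : Domain d} {φ : L2 Λ n} {u : Fin n → Fin d → L2 Λ n}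
    (ha : IsAntisymmetric φ) (hu : HasDirichletGradient φ u) (hn : 0 < n)
    (hΛ : 0 < (volume Λ.carrier).toReal) :
    energyConst d * (n / (volume Λ.carrier).toReal) ^ (2 / (d : ℝ)) * n * ‖φ‖ ^ 2 ≤
      ∑ i, ∑ j, ‖u i j‖ ^ 2 := by
  set v := (volume Λ.carrier).toReal
  have hn' : (0 : ℝ) < n := by exact_mod_cast hn
  have hd' : (0 : ℝ) < d := by exact_mod_cast hd
  -- With l^d = 2v/n the volume term is exactly half of the left side of the exclusion inequality.
  set l : ℝ := (2 * v / n) ^ (1 / (d : ℝ)) with hl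
  have hl0 : 0 < l := by positivity
  have hld : l ^ d = 2 * v / n := by
    rw [hl, ← Real.rpow_natCast, ← Real.rpow_mul (by positivity), one_div,
      inv_mul_cancel₀ hd'.ne', Real.rpow_one]
  have hl2 : (1 / 2 : ℝ) ^ (2 / (d : ℝ)) * (n / v) ^ (2 / (d : ℝ)) * l ^ 2 = 1 := by
    rw [hl, ← Real.rpow_natCast, ← Real.rpow_mul (by positivity), one_div_mul_eq_div,
      ← Real.mul_rpow (by positivity) (by positivity), Nat.cast_ofNat,
      ← Real.mul_rpow (by positivity) (by positivity)]
    have : 1 / 2 * (n / v) * (2 * v / n) = 1 := by field_simp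
    rw [this, Real.one_rpow]
  have key := kinetic_energy_ge_of_scale ha hu hl0
  rw [← Finset.mul_sum, hld] at key
  set T := ∑ i, ∑ j, ‖u i j‖ ^ 2
  have hT : 0 ≤ T := by positivity
  have h1 : n * ‖φ‖ ^ 2 ≤ l ^ 2 * d * T := by
    have h2 : 2 * v / n * (n * ‖φ‖ ^ 2) ≤ 2 * v / n * (l ^ 2 * d * T) := by
      have h3 : 2 * n * (2 * v / n) * ‖φ‖ ^ 2 = 4 * v * ‖φ‖ ^ 2 := by field_simp; ring
      have h4 : 2 * v / n * (n * ‖φ‖ ^ 2) = 2 * v * ‖φ‖ ^ 2 := by field_simp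
      linarith
    exact le_of_mul_le_mul_left h2 (by positivity)
  -- The spare factor 1/4 in `energyConst` is needed on the lattice, where the side is rounded.
  have h5 : energyConst d * (n / v) ^ (2 / (d : ℝ)) * (l ^ 2 * d * T) = T / 4 := by
    calc _ = ((1 / 2 : ℝ) ^ (2 / (d : ℝ)) * (n / v) ^ (2 / (d : ℝ)) * l ^ 2) * (T / 4) := by
          unfold energyConst; field_simp
      _ = _ := by rw [hl2, one_mul]
  calc _ = energyConst d * (n / v) ^ (2 / (d : ℝ)) * (n * ‖φ‖ ^ 2) := by ring
    _ ≤ energyConst d * (n / v) ^ (2 / (d : ℝ)) * (l ^ 2 * d * T) := by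
        have := energyConst_pos hd
        gcongr
    _ ≤ T := by rw [h5]; linarith

/-- Test the form identity with ψ = φ and drop the nonnegative potential term. -/
theorem norm_sq_gradient_le_re_inner {V : Space d → ℝ} (hV : ∀ᵐ x, 0 ≤ V x) {Λ : Domain d}
    {φ f : L2 Λ n} {u : Fin n → Fin d → L2 Λ n} (hu : InFormDomain V φ u)
    (h : ∀ (ψ : L2 Λ n) (w : Fin n → Fin d → L2 Λ n), InFormDomain V ψ w →
      (∑ i, ∑ j, inner ℂ (u i j) (w i j)) +
        ∫ x, ((∑ i, V (x i) : ℝ) : ℂ) * (conj (φ x) * ψ x) ∂(boxMeasure Λ n) = inner ℂ f ψ) :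
    ∑ i, ∑ j, ‖u i j‖ ^ 2 ≤ (inner ℂ f φ : ℂ).re := by
  rw [← h φ u hu]
  have h1 : ∀ᵐ x ∂(boxMeasure Λ n), 0 ≤ ∑ i, V (x i) := by
    have h2 : ∀ᵐ x : Config d n, ∀ i, 0 ≤ V (x i) := by
      rw [ae_all_iff]
      intro i
      have := Measure.quasiMeasurePreserving_eval (fun _ : Fin n => (volume : Measure (Space d))) i
      exact this.ae hV
    filter_upwards [ae_restrict_of_ae h2] with x hx using Finset.sum_nonneg fun i _ => hx i
  have h3 : ∫ x, ((∑ i, V (x i) : ℝ) : ℂ) * (conj (φ x) * φ x) ∂(boxMeasure Λ n) =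
      ((∫ x, (∑ i, V (x i)) * ‖φ x‖ ^ 2 ∂(boxMeasure Λ n) : ℝ) : ℂ) := by
    rw [← integral_complex_ofReal]
    refine integral_congr_ae (Eventually.of_forall fun x => ?_)
    simp only [Complex.conj_mul']
    push_cast
    ring
  have h4 : 0 ≤ ∫ x, (∑ i, V (x i)) * ‖φ x‖ ^ 2 ∂(boxMeasure Λ n) := by
    refine integral_nonneg_of_ae ?_
    filter_upwards [h1] with x hx using mul_nonneg hx (sq_nonneg _)
  rw [h3, Complex.add_re, Complex.ofReal_re]
  simp only [inner_self_eq_norm_sq_to_K]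
  have h5 : ∑ i, ∑ j, (Complex.ofReal ‖u i j‖) ^ 2 = ((∑ i, ∑ j, ‖u i j‖ ^ 2 : ℝ) : ℂ) := by push_cast; rfl
  erw [h5, Complex.ofReal_re]
  linarith

theorem groundEnergy_ge (hd : 0 < d) {V : Space d → ℝ} (hV : ∀ᵐ x, 0 ≤ V x) (Λ : Domain d)
    (hn : 0 < n) (hΛ : 0 < (volume Λ.carrier).toReal) :
    ((energyConst d * (n / (volume Λ.carrier).toReal) ^ (2 / (d : ℝ)) : ℝ) : EReal) ≤
      groundEnergy V Λ n / ((n : ℝ) : EReal) := by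
  have hn' : (0 : ℝ) < n := by exact_mod_cast hn
  rw [EReal.le_div_iff_mul_le (by exact_mod_cast hn') (EReal.coe_ne_top _), ← EReal.coe_mul]
  refine le_iInf fun ⟨⟨φ, f⟩, ⟨_, u, hu, h⟩, hne⟩ => ?_
  rw [EReal.coe_le_coe_iff, le_div_iff₀ (pow_pos (norm_pos_iff.2 hne) 2)]
  exact (kinetic_energy_ge hd hu.1 hu.2.1 hn hΛ).trans (norm_sq_gradient_le_re_inner hV hu h)

end Continuum
end FermionGas

namespace FermionGas

/-! ### The energy bound on the lattice -/

section Lattice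

/-- Triangle inequality through the intermediate point x + v, with translation invariance. It
replaces the integration of the gradient along a segment by a walk in unit steps. -/
theorem eLpNorm_sub_translate_add_le {E : Type*} [AddCommGroup E] [MeasurableSpace E]
    [MeasurableAdd E] {μ : Measure E} [μ.IsAddRightInvariant] {φ : E → ℂ}
    (hφ : AEStronglyMeasurable φ μ) (v w : E) :
    eLpNorm (fun x => φ x - φ (x + (v + w))) 2 μ ≤
      eLpNorm (fun x => φ x - φ (x + v)) 2 μ + eLpNorm (fun x => φ x - φ (x + w)) 2 μ := by
  have hv := measurePreserving_add_right μ v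
  have hτ : ∀ y, AEStronglyMeasurable (fun x => φ (x + y)) μ := fun y =>
    hφ.comp_measurePreserving (measurePreserving_add_right μ y)
  have h1 : (fun x => φ x - φ (x + (v + w))) = (fun x => φ x - φ (x + v)) +
      (fun x => φ x - φ (x + w)) ∘ fun x => x + v := by
    funext x
    simp [add_assoc]
  have h2 : eLpNorm ((fun x => φ x - φ (x + w)) ∘ fun x => x + v) 2 μ =
      eLpNorm (fun x => φ x - φ (x + w)) 2 μ :=
    eLpNorm_comp_measurePreserving (hφ.sub (hτ w)) hv
  rw [h1, ← h2]
  exact eLpNorm_add_le (hφ.sub (hτ v)) ((hφ.sub (hτ w)).comp_measurePreserving hv) one_le_two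

theorem eLpNorm_sub_translate_neg {E : Type*} [AddCommGroup E] [MeasurableSpace E]
    [MeasurableAdd E] {μ : Measure E} [μ.IsAddRightInvariant] {φ : E → ℂ}
    (hφ : AEStronglyMeasurable φ μ) (v : E) :
    eLpNorm (fun x => φ x - φ (x + -v)) 2 μ = eLpNorm (fun x => φ x - φ (x + v)) 2 μ := by
  have hτ : AEStronglyMeasurable (fun x => φ (x + v)) μ :=
    hφ.comp_measurePreserving (measurePreserving_add_right μ v)
  have h1 : eLpNorm ((fun x => φ x - φ (x + v)) ∘ fun x => x + -v) 2 μ =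
      eLpNorm (fun x => φ x - φ (x + v)) 2 μ :=
    eLpNorm_comp_measurePreserving (hφ.sub hτ) (measurePreserving_add_right μ (-v))
  rw [← h1, ← eLpNorm_neg]
  congr 1
  funext x
  simp

theorem eLpNorm_sub_translate_zsmul_le {E : Type*} [AddCommGroup E] [MeasurableSpace E]
    [MeasurableAdd E] {μ : Measure E} [μ.IsAddRightInvariant] {φ : E → ℂ}
    (hφ : AEStronglyMeasurable φ μ) (k : ℤ) (v : E) :
    eLpNorm (fun x => φ x - φ (x + k • v)) 2 μ ≤
      ENNReal.ofReal |(k : ℝ)| * eLpNorm (fun x => φ x - φ (x + v)) 2 μ := by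
  have hnat : ∀ m : ℕ, eLpNorm (fun x => φ x - φ (x + m • v)) 2 μ ≤
      m * eLpNorm (fun x => φ x - φ (x + v)) 2 μ := by
    intro m
    induction m with
    | zero => simp
    | succ m ih =>
      rw [succ_nsmul, Nat.cast_succ, add_mul, one_mul]
      exact (eLpNorm_sub_translate_add_le hφ _ _).trans (by gcongr)
  obtain ⟨m, rfl | rfl⟩ := k.eq_nat_or_neg
  · simpa using hnat m
  · rw [neg_smul, eLpNorm_sub_translate_neg hφ]
    simpa using hnat m

variable {d n : ℕ}

theorem pi_count {ι X : Type*} [Fintype ι] [Countable X] [MeasurableSpace X]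
    [MeasurableSingletonClass X] :
    (Measure.pi fun _ : ι => (Measure.count : Measure X)) = Measure.count := by
  refine Measure.ext_of_singleton fun x => ?_
  rw [Measure.pi_singleton]
  simp

/-- The kinetic energy of the `i`-th particle in the direction `j`. -/
noncomputable def latticeKinetic (φ : (Fin n → Lattice d) → ℂ) (i : Fin n) (j : Fin d) : ℝ :=
  ∑' x, ‖φ x - φ (x + latticeStep i j)‖ ^ 2

theorem latticeKinetic_nonneg (φ : (Fin n → Lattice d) → ℂ) (i : Fin n) (j : Fin d) :
    0 ≤ latticeKinetic φ i j := tsum_nonneg fun _ => sq_nonneg _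

theorem finite_support_translate {E : Type*} [AddGroup E] {φ : E → ℂ} (hφ : φ.support.Finite)
    (v : E) : (fun x => φ (x + v)).support.Finite :=
  hφ.preimage (f := fun x => x + v) (add_left_injective v).injOn

theorem finite_support_of_mem {Λ : Finset (Lattice d)} {φ : (Fin n → Lattice d) → ℂ}
    (hφ : φ ∈ latticeFermions Λ n) : φ.support.Finite := by
  refine (Fintype.piFinset fun _ : Fin n => Λ).finite_toSet.subset fun x hx => ?_
  rw [Finset.mem_coe, Fintype.mem_piFinset]
  intro i
  by_contra h
  exact hx (hφ.1 x ⟨i, h⟩)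

theorem eLpNorm_count_sq {X : Type*} [MeasurableSpace X] [MeasurableSingletonClass X]
    {f : X → ℂ} (hf : f.support.Finite) :
    eLpNorm f 2 Measure.count ^ 2 = ENNReal.ofReal (∑' x, ‖f x‖ ^ 2) := by
  have hs : Summable fun x => ‖f x‖ ^ 2 :=
    summable_of_hasFiniteSupport (hf.subset fun x hx h => hx (by simp [h]))
  rw [eLpNorm_two_sq, lintegral_count, ENNReal.ofReal_tsum_of_nonneg (fun _ => sq_nonneg _) hs]
  refine tsum_congr fun x => ?_
  rw [ENNReal.ofReal_pow (norm_nonneg _), ofReal_norm]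

/-- A displacement h is walked axis by axis, with |hⱼ| unit steps in direction j, each costing the
square root of the kinetic term. -/
theorem eLpNorm_sub_translate_lattice_le {φ : (Fin n → Lattice d) → ℂ} (hφ : φ.support.Finite)
    (i : Fin n) (h : Lattice d) :
    eLpNorm (fun x => φ x - φ (x + Pi.single i h)) 2 Measure.count ≤
      ENNReal.ofReal (∑ j, |(h j : ℝ)| * √(latticeKinetic φ i j)) := by
  have hm : AEStronglyMeasurable φ Measure.count :=
    (measurable_of_countable φ).aestronglyMeasurable
  have h1 : (Pi.single i h : Fin n → Lattice d) = ∑ j, h j • latticeStep i j := by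
    funext k
    rw [Finset.sum_apply]
    funext m
    rw [Finset.sum_apply]
    rcases eq_or_ne k i with rfl | hk
    · simp [latticeStep, Pi.single_apply]
    · simp [latticeStep, hk]
  have h2 : ∀ s : Finset (Fin d),
      eLpNorm (fun x => φ x - φ (x + ∑ j ∈ s, h j • latticeStep i j)) 2 Measure.count ≤
        ∑ j ∈ s, eLpNorm (fun x => φ x - φ (x + h j • latticeStep i j)) 2 Measure.count := by
    intro s
    induction s using Finset.induction_on with
    | empty => simp
    | insert j s hj ih =>
      rw [Finset.sum_insert hj, Finset.sum_insert hj]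
      exact (eLpNorm_sub_translate_add_le hm _ _).trans (by gcongr)
  rw [h1, ENNReal.ofReal_sum_of_nonneg fun j _ => by positivity]
  refine (h2 _).trans (Finset.sum_le_sum fun j _ => ?_)
  refine (eLpNorm_sub_translate_zsmul_le hm _ _).trans ?_
  rw [ENNReal.ofReal_mul (abs_nonneg _)]
  gcongr
  rw [← ENNReal.pow_le_pow_left_iff two_ne_zero, eLpNorm_count_sq,
    ← ENNReal.ofReal_pow (Real.sqrt_nonneg _), Real.sq_sqrt (latticeKinetic_nonneg φ i j)]
  · rfl
  · exact (hφ.union (finite_support_translate hφ _)).subset (Function.support_sub _ _)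

theorem isAlternating_of_mem {Λ : Finset (Lattice d)} {φ : (Fin n → Lattice d) → ℂ}
    (hφ : φ ∈ latticeFermions Λ n) {i j : Fin n} (hij : i ≠ j) (x : Fin n → Lattice d) :
    φ (x ∘ Equiv.swap i j) = - φ x := by
  have := hφ.2 (Equiv.swap i j) x
  rw [Equiv.Perm.sign_swap hij, Units.val_neg, Units.val_one, Int.cast_neg, Int.cast_one,
    neg_one_mul] at this
  exact this

theorem lattice_kinetic_energy_ge_of_scale {Λ : Finset (Lattice d)} {φ : (Fin n → Lattice d) → ℂ}
    (hφ : φ ∈ latticeFermions Λ n) {l : ℕ} (hl : 0 < l) :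
    2 * n * (l : ℝ) ^ d * ∑' x, ‖φ x‖ ^ 2 ≤ 2 * (Λ.card : ℝ) * ∑' x, ‖φ x‖ ^ 2 +
      (l : ℝ) ^ d * ∑ i, (l : ℝ) ^ 2 * d * ∑ j, latticeKinetic φ i j := by
  have hfin := finite_support_of_mem hφ
  set B : Finset (Lattice d) := Fintype.piFinset fun _ => Finset.Ico (0 : ℤ) l with hB
  have hBc : Measure.count (B : Set (Lattice d)) = ENNReal.ofReal ((l : ℝ) ^ d) := by
    rw [Measure.count_apply_finset, hB, Fintype.card_piFinset]
    simp [ENNReal.ofReal_pow]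
  have hΛc : Measure.count (Λ : Set (Lattice d)) = ENNReal.ofReal (Λ.card : ℝ) := by
    rw [Measure.count_apply_finset, ENNReal.ofReal_natCast]
  have hN : ∫⁻ x, ‖φ x‖ₑ ^ 2 ∂(Measure.pi fun _ : Fin n => (Measure.count : Measure (Lattice d))) =
      ENNReal.ofReal (∑' x, ‖φ x‖ ^ 2) := by
    rw [pi_count, ← eLpNorm_two_sq, eLpNorm_count_sq hfin]
  have key := exclusion_principle (Measure.count : Measure (Lattice d)) (φ := φ)
    (measurable_of_countable φ) (Λ := (Λ : Set (Lattice d))) (B := (B : Set (Lattice d)))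
    ⟨(measurable_of_countable φ).aestronglyMeasurable, by
      refine lt_top_iff_ne_top.2 fun h => ?_
      rw [← eLpNorm_two_sq, h] at hN
      simp at hN⟩
    (fun i j hij => Eventually.of_forall (isAlternating_of_mem hφ hij)) Λ.measurableSet
    hφ.1 B.measurableSet (by rw [hBc]; exact ENNReal.ofReal_ne_top)
    (by rw [hBc]; exact (ENNReal.ofReal_pos.2 (pow_pos (Nat.cast_pos.2 hl) d)).ne')
    (fun i => ENNReal.ofReal ((l : ℝ) ^ 2 * d * ∑ j, latticeKinetic φ i j)) ?_
  · have hnn : ∀ i, 0 ≤ (l : ℝ) ^ 2 * d * ∑ j, latticeKinetic φ i j := fun i =>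
      mul_nonneg (by positivity) (Finset.sum_nonneg fun j _ => latticeKinetic_nonneg φ i j)
    rw [hBc, hΛc, hN, ← ENNReal.ofReal_sum_of_nonneg fun i _ => hnn i] at key
    exact le_of_ennreal_le (by positivity) (by positivity) (tsum_nonneg fun _ => sq_nonneg _)
      (Finset.sum_nonneg fun i _ => hnn i) key
  · intro i b hb b' hb'
    rw [pi_count, ← eLpNorm_two_sq]
    have h1 : ∀ x : Fin n → Lattice d,
        Function.update x i (x i + (b - b')) = x + Pi.single i (b - b') := by
      intro x
      funext k
      rcases eq_or_ne k i with rfl | hk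
      · simp
      · simp [hk]
    simp only [h1]
    refine (pow_le_pow_left' (eLpNorm_sub_translate_lattice_le hfin i (b - b')) 2).trans ?_
    rw [← ENNReal.ofReal_pow (by positivity)]
    refine ENNReal.ofReal_le_ofReal ?_
    have h2 : ∀ j, |((b - b') j : ℝ)| ≤ l := by
      intro j
      have h3 := Finset.mem_Ico.1 (Fintype.mem_piFinset.1 (Finset.mem_coe.1 hb) j)
      have h4 := Finset.mem_Ico.1 (Fintype.mem_piFinset.1 (Finset.mem_coe.1 hb') j)
      have h5 : |b j - b' j| ≤ l := abs_le.2 ⟨by linarith [h3.1, h4.2], by linarith [h3.2, h4.1]⟩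
      rw [Pi.sub_apply]
      exact_mod_cast h5
    refine (sq_sum_abs_mul_le h2 fun j => Real.sqrt_nonneg _).trans_eq ?_
    simp only [Real.sq_sqrt (latticeKinetic_nonneg φ i _)]

/-- Pigeonhole: with more particles than sites two of them share a site, and swapping them gives
φ(x) = -φ(x). -/
theorem card_le_of_mem {Λ : Finset (Lattice d)} {φ : (Fin n → Lattice d) → ℂ}
    (hφ : φ ∈ latticeFermions Λ n) (hne : φ ≠ 0) : n ≤ Λ.card := by
  by_contra! hlt
  obtain ⟨x, hx⟩ := Function.ne_iff.1 hne
  have hmem : ∀ i ∈ (Finset.univ : Finset (Fin n)), x i ∈ Λ := fun i _ => by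
    by_contra h
    exact hx (hφ.1 x ⟨i, h⟩)
  obtain ⟨i, -, j, -, hij, he⟩ := Finset.exists_ne_map_eq_of_card_lt_of_maps_to
    (by simpa using hlt) hmem
  have h1 := isAlternating_of_mem hφ hij x
  have h2 : x ∘ Equiv.swap i j = x := by
    funext k
    simp only [Function.comp]
    rcases eq_or_ne k i with rfl | hi
    · simp [he]
    rcases eq_or_ne k j with rfl | hj
    · simp [he]
    · rw [Equiv.swap_apply_of_ne_of_ne hi hj]
  rw [h2] at h1
  exact hx (self_eq_neg.1 h1)

theorem lattice_kinetic_energy_ge (hd : 0 < d) {Λ : Finset (Lattice d)}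
    {φ : (Fin n → Lattice d) → ℂ} (hφ : φ ∈ latticeFermions Λ n) (hne : φ ≠ 0) (hn : 0 < n) :
    energyConst d * (n / (Λ.card : ℝ)) ^ (2 / (d : ℝ)) * n * ∑' x, ‖φ x‖ ^ 2 ≤
      ∑ i, ∑ j, latticeKinetic φ i j := by
  have hcard := card_le_of_mem hφ hne
  set v : ℝ := (Λ.card : ℝ)
  have hn' : (0 : ℝ) < n := by exact_mod_cast hn
  have hnv : (n : ℝ) ≤ v := Nat.cast_le.2 hcard
  have hv : 0 < v := hn'.trans_le hnv
  have hd' : (0 : ℝ) < d := by exact_mod_cast hd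
  set r : ℝ := (2 * v / n) ^ (1 / (d : ℝ)) with hr
  have hr0 : 0 < r := by positivity
  -- From n ≤ |Λ|. It makes the rounding harmless: ⌈r⌉ < r + 1 ≤ 2r.
  have hr1 : 1 ≤ r := by
    refine Real.one_le_rpow ?_ (by positivity)
    rw [le_div_iff₀ hn']
    linarith
  have hrd : r ^ d = 2 * v / n := by
    rw [hr, ← Real.rpow_natCast, ← Real.rpow_mul (by positivity), one_div,
      inv_mul_cancel₀ hd'.ne', Real.rpow_one]
  have hr2 : (1 / 2 : ℝ) ^ (2 / (d : ℝ)) * (n / v) ^ (2 / (d : ℝ)) * r ^ 2 = 1 := by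
    rw [hr, ← Real.rpow_natCast, ← Real.rpow_mul (by positivity), one_div_mul_eq_div,
      ← Real.mul_rpow (by positivity) (by positivity), Nat.cast_ofNat,
      ← Real.mul_rpow (by positivity) (by positivity)]
    have : 1 / 2 * (n / v) * (2 * v / n) = 1 := by field_simp
    rw [this, Real.one_rpow]
  set l : ℕ := ⌈r⌉₊
  have hrl : r ≤ l := Nat.le_ceil r
  have hl2 : (l : ℝ) ≤ 2 * r := by linarith [Nat.ceil_lt_add_one hr0.le]
  have hl0 : 0 < l := Nat.ceil_pos.2 hr0
  have key := lattice_kinetic_energy_ge_of_scale hφ hl0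
  rw [← Finset.mul_sum] at key
  set T := ∑ i, ∑ j, latticeKinetic φ i j
  set N := ∑' x, ‖φ x‖ ^ 2
  have hT : 0 ≤ T := Finset.sum_nonneg fun i _ => Finset.sum_nonneg fun j _ =>
    latticeKinetic_nonneg φ i j
  have hN : 0 ≤ N := tsum_nonneg fun _ => sq_nonneg _
  have h1 : n * N ≤ 4 * r ^ 2 * d * T := by
    have hld : 2 * v ≤ n * (l : ℝ) ^ d := by
      have := pow_le_pow_left₀ hr0.le hrl d
      rw [hrd, div_le_iff₀ hn'] at this
      linarith
    have h2 : (l : ℝ) ^ d * (n * N) ≤ (l : ℝ) ^ d * ((l : ℝ) ^ 2 * d * T) := by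
      have := mul_le_mul_of_nonneg_right hld hN
      linarith
    refine (le_of_mul_le_mul_left h2 (by positivity)).trans ?_
    have h3 : (l : ℝ) ^ 2 ≤ (2 * r) ^ 2 := pow_le_pow_left₀ (by positivity) hl2 2
    have h4 : (2 * r) ^ 2 = 4 * r ^ 2 := by ring
    rw [h4] at h3
    gcongr
  have h5 : energyConst d * (n / v) ^ (2 / (d : ℝ)) * (4 * r ^ 2 * d * T) = T := by
    calc _ = ((1 / 2 : ℝ) ^ (2 / (d : ℝ)) * (n / v) ^ (2 / (d : ℝ)) * r ^ 2) * T := by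
          unfold energyConst; field_simp
      _ = _ := by rw [hr2, one_mul]
  calc _ = energyConst d * (n / v) ^ (2 / (d : ℝ)) * (n * N) := by ring
    _ ≤ energyConst d * (n / v) ^ (2 / (d : ℝ)) * (4 * r ^ 2 * d * T) := by
        have := energyConst_pos hd
        gcongr
    _ = T := h5

/-- Summation by parts. -/
theorem tsum_re_laplacian {E : Type*} [AddCommGroup E] {φ : E → ℂ} (hφ : φ.support.Finite) (v : E) :
    ∑' x, (conj ((φ x - φ (x + v)) + (φ x - φ (x - v))) * φ x).re = ∑' x, ‖φ x - φ (x + v)‖ ^ 2 := by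
  have hs : ∀ f : E → ℂ, Summable fun x => (conj (f x) * φ x).re := fun f =>
    summable_of_hasFiniteSupport (hφ.subset fun x hx h => hx (by simp [h]))
  have hs' : ∀ f : E → ℂ, Summable fun x => (conj (f x) * φ (x + v)).re := fun f =>
    summable_of_hasFiniteSupport
      ((finite_support_translate hφ v).subset fun x hx h => hx (by simp [h]))
  have h1 : ∀ x, ‖φ x - φ (x + v)‖ ^ 2 =
      (conj (φ x - φ (x + v)) * φ x).re - (conj (φ x - φ (x + v)) * φ (x + v)).re := by
    intro x
    rw [← Complex.sub_re, ← mul_sub, Complex.conj_mul']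
    norm_cast
  have h2 : ∑' x, (conj (φ x - φ (x + v)) * φ (x + v)).re =
      ∑' x, (conj (φ (x - v) - φ x) * φ x).re := by
    rw [← (Equiv.addRight v).tsum_eq fun x => (conj (φ (x - v) - φ x) * φ x).re]
    simp
  simp only [h1]
  rw [(hs fun x => φ x - φ (x + v)).tsum_sub (hs' fun x => φ x - φ (x + v)), h2,
    ← (hs fun x => φ x - φ (x + v)).tsum_sub (hs fun x => φ (x - v) - φ x)]
  refine tsum_congr fun x => ?_
  rw [← Complex.sub_re, ← sub_mul, ← map_sub]
  congr 4
  ring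

/-- Summation by parts for each particle and direction; sums over Λ^n suffice because φ vanishes
elsewhere, and the potential term is nonnegative. -/
theorem latticeKinetic_le_re {Λ : Finset (Lattice d)} {φ : (Fin n → Lattice d) → ℂ}
    (hφ : φ ∈ latticeFermions Λ n) {V : Lattice d → ℝ} (hV : ∀ x, 0 ≤ V x) :
    ∑ i, ∑ j, latticeKinetic φ i j ≤
      (∑ x ∈ Fintype.piFinset fun _ => Λ, conj (latticeHamiltonian V φ x) * φ x).re := by
  have hfin := finite_support_of_mem hφ
  have hzero : ∀ x ∉ Fintype.piFinset fun _ : Fin n => Λ, φ x = 0 := by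
    intro x hx
    rw [Fintype.mem_piFinset] at hx
    exact hφ.1 x (not_forall.1 hx)
  have h1 : ∀ i j, latticeKinetic φ i j = ∑ x ∈ Fintype.piFinset fun _ : Fin n => Λ,
      (conj ((φ x - φ (x + latticeStep i j)) + (φ x - φ (x - latticeStep i j))) * φ x).re := by
    intro i j
    rw [latticeKinetic, ← tsum_re_laplacian hfin, tsum_eq_sum fun x hx => by simp [hzero x hx]]
  simp only [h1]
  rw [Complex.re_sum]
  simp only [Finset.sum_comm (t := Fintype.piFinset fun _ : Fin n => Λ)]
  refine Finset.sum_le_sum fun x _ => ?_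
  have h2 : (conj (latticeHamiltonian V φ x) * φ x).re =
      (∑ i, ∑ j, (conj ((φ x - φ (x + latticeStep i j)) +
        (φ x - φ (x - latticeStep i j))) * φ x).re) + ∑ i, V (x i) * ‖φ x‖ ^ 2 := by
    simp only [latticeHamiltonian, map_sum, Finset.sum_mul, Complex.re_sum]
    rw [← Finset.sum_add_distrib]
    refine Finset.sum_congr rfl fun i _ => ?_
    rw [map_add, add_mul, Complex.add_re, map_sum, Finset.sum_mul, Complex.re_sum, map_mul,
      Complex.conj_ofReal, mul_assoc, Complex.conj_mul']
    norm_cast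
  rw [h2]
  have h3 : 0 ≤ ∑ i, V (x i) * ‖φ x‖ ^ 2 :=
    Finset.sum_nonneg fun i _ => mul_nonneg (hV _) (sq_nonneg _)
  linarith

theorem latticeGroundEnergy_ge (hd : 0 < d) {V : Lattice d → ℝ} (hV : ∀ x, 0 ≤ V x)
    (Λ : Finset (Lattice d)) (hn : 0 < n) :
    ((energyConst d * (n / (Λ.card : ℝ)) ^ (2 / (d : ℝ)) : ℝ) : EReal) ≤
      latticeGroundEnergy V Λ n / ((n : ℝ) : EReal) := by
  have hn' : (0 : ℝ) < n := by exact_mod_cast hn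
  rw [EReal.le_div_iff_mul_le (by exact_mod_cast hn') (EReal.coe_ne_top _), ← EReal.coe_mul]
  refine le_iInf fun ⟨φ, hφ, hne⟩ => ?_
  have hzero : ∀ x ∉ Fintype.piFinset fun _ : Fin n => Λ, φ x = 0 := by
    intro x hx
    rw [Fintype.mem_piFinset] at hx
    exact hφ.1 x (not_forall.1 hx)
  have h1 := lattice_kinetic_energy_ge hd hφ hne hn
  rw [tsum_eq_sum (s := Fintype.piFinset fun _ : Fin n => Λ) fun x hx => by simp [hzero x hx]] at h1
  obtain ⟨x, hx⟩ := Function.ne_iff.1 hne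
  have hpos : 0 < ∑ x ∈ Fintype.piFinset fun _ : Fin n => Λ, ‖φ x‖ ^ 2 :=
    Finset.sum_pos' (fun _ _ => sq_nonneg _)
      ⟨x, by_contra fun h => hx (hzero x h), pow_pos (norm_pos_iff.2 hx) 2⟩
  rw [EReal.coe_le_coe_iff, le_div_iff₀ hpos]
  exact h1.trans (latticeKinetic_le_re hφ hV)

/-- The volume of a lattice domain is its number of sites. -/
theorem volume_cells (Λ : Finset (Lattice d)) : volume (cells Λ) = Λ.card := by
  have h1 : cells Λ = ⋃ z ∈ Λ, {x : Space d | ∀ j, x j ∈ Set.Ico (z j : ℝ) (z j + 1)} := by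
    ext x
    simp only [cells, Set.mem_iUnion, exists_prop]
    constructor
    · intro hx
      exact ⟨_, hx, fun j => ⟨Int.floor_le _, Int.lt_floor_add_one _⟩⟩
    · rintro ⟨z, hz, hx⟩
      have : (fun j => ⌊x j⌋) = z := funext fun j => Int.floor_eq_iff.2 (hx j)
      change (fun j => ⌊x j⌋) ∈ Λ
      rwa [this]
  rw [h1, measure_biUnion_finset]
  · simp only [volume_box fun j => Set.Ico (_ : ℝ) (_ + 1)]
    simp [Real.volume_Ico]
  · intro z _ w _ hzw
    refine Set.disjoint_left.2 fun x hx hx' => hzw ?_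
    funext j
    rw [← Int.floor_eq_iff.2 (hx j), ← Int.floor_eq_iff.2 (hx' j)]
  · exact fun z _ => measurableSet_box fun _ => measurableSet_Ico

end Lattice
end FermionGas

namespace FermionGas

/-! ### Growing cubes form a thermodynamic limit -/

section Cubes

variable {d : ℕ}

/-- Sets between the open and the closed cube of side `L k → ∞` tend to infinity. -/
theorem tendsToInfinityFisher_of_cubes (hd : 0 < d) {S : ℕ → Set (Space d)} {L : ℕ → ℝ}
    (hL0 : ∀ k, 0 < L k) (hL : Tendsto L atTop atTop)
    (h1 : ∀ k, {x : Space d | ∀ j, x j ∈ Set.Ioo 0 (L k)} ⊆ S k)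
    (h2 : ∀ k, S k ⊆ {x : Space d | ∀ j, x j ∈ Set.Icc 0 (L k)}) :
    (∀ k, volume (S k) = ENNReal.ofReal (L k ^ d)) ∧ TendsToInfinityFisher S := by
  have hvol : ∀ k, volume (S k) = ENNReal.ofReal (L k ^ d) := by
    intro k
    refine le_antisymm ((measure_mono (h2 k)).trans_eq ?_) (le_trans (le_of_eq ?_) (measure_mono (h1 k)))
    · rw [volume_box]
      simp [ENNReal.ofReal_pow (hL0 k).le]
    · rw [volume_box]
      simp [ENNReal.ofReal_pow (hL0 k).le]
  have hd' : (0 : ℝ) < d := by exact_mod_cast hd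
  -- The diameter is at most √d L, so the boundary neighbourhood lies in the shell between the cubes
  -- of sides L(1 ± 2α√d), whose relative volume is this function. The bound 1/(2√d) on α keeps the
  -- inner side positive.
  refine ⟨hvol, ?_, fun α => (1 + 2 * (α * √d)) ^ d - (1 - 2 * (α * √d)) ^ d, ?_, 1 / (2 * √d),
    by positivity, ?_⟩
  · simp only [hvol]
    exact ENNReal.tendsto_ofReal_atTop.comp ((tendsto_pow_atTop hd.ne').comp hL)
  · have hc : Continuous fun α : ℝ => (1 + 2 * (α * √d)) ^ d - (1 - 2 * (α * √d)) ^ d := by fun_prop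
    have := hc.tendsto 0
    simp only [zero_mul, mul_zero, add_zero, sub_zero, one_pow, sub_self] at this
    exact this.mono_left nhdsWithin_le_nhds
  · intro α hα0 hα k
    have hs : 0 < √(d : ℝ) := Real.sqrt_pos.2 hd'
    have hL := hL0 k
    have hα' : 2 * (α * √d) < 1 := by
      rw [lt_div_iff₀ (by positivity)] at hα
      linarith
    set δ : ℝ := α * √d * L k with hδ
    have hδ0 : 0 < δ := by positivity
    have hδL : 2 * δ < L k := by
      have := mul_lt_mul_of_pos_right hα' hL
      rw [hδ]; linarith
    have hdiam : Metric.diam (S k) ≤ √d * L k := by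
      refine Metric.diam_le_of_forall_dist_le (by positivity) fun x hx y hy => ?_
      rw [EuclideanSpace.dist_eq, ← Real.sqrt_sq hL.le, ← Real.sqrt_mul hd'.le]
      refine Real.sqrt_le_sqrt ?_
      have h3 : ∀ j ∈ Finset.univ, dist (x j) (y j) ^ 2 ≤ L k ^ 2 := by
        intro j _
        have hxj := h2 k hx j
        have hyj := h2 k hy j
        refine pow_le_pow_left₀ dist_nonneg ?_ 2
        rw [Real.dist_eq, abs_le]
        constructor <;> linarith [hxj.1, hxj.2, hyj.1, hyj.2]
      simpa using Finset.sum_le_card_nsmul _ _ _ h3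
    have hclosed : IsClosed {x : Space d | ∀ j, x j ∈ Set.Icc 0 (L k)} := by
      have : {x : Space d | ∀ j, x j ∈ Set.Icc 0 (L k)} =
          ⋂ j, (fun x : Space d => x j) ⁻¹' Set.Icc 0 (L k) := by
        ext x; simp
      rw [this]
      exact isClosed_iInter fun j => isClosed_Icc.preimage (by fun_prop)
    have hopen : IsOpen {x : Space d | ∀ j, x j ∈ Set.Ioo 0 (L k)} := by
      have : {x : Space d | ∀ j, x j ∈ Set.Ioo 0 (L k)} =
          ⋂ j, (fun x : Space d => x j) ⁻¹' Set.Ioo 0 (L k) := by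
        ext x; simp
      rw [this]
      exact isOpen_iInter_of_finite fun j => isOpen_Ioo.preimage (by fun_prop)
    have hsub : Metric.thickening (α * Metric.diam (S k)) (frontier (S k)) ⊆
        {x : Space d | ∀ j, x j ∈ Set.Icc (-δ) (L k + δ)} \
          {x : Space d | ∀ j, x j ∈ Set.Ioo δ (L k - δ)} := by
      intro x hx
      obtain ⟨y, hy, hxy⟩ := Metric.mem_thickening_iff.1 hx
      have hxyδ : dist x y < δ := hxy.trans_le (by
        rw [hδ, mul_assoc]; exact mul_le_mul_of_nonneg_left hdiam hα0.le)
      have hcoord : ∀ j, |x j - y j| < δ := fun j => by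
        rw [dist_eq_norm] at hxyδ
        exact (PiLp.norm_apply_le (x - y) j).trans_lt hxyδ
      have hy1 : ∀ j, y j ∈ Set.Icc 0 (L k) := closure_minimal (h2 k) hclosed hy.1
      have hy2 : ¬ ∀ j, y j ∈ Set.Ioo 0 (L k) := fun h => hy.2 (interior_maximal (h1 k) hopen h)
      refine ⟨fun j => ?_, fun h => hy2 fun j => ?_⟩
      · have := abs_lt.1 (hcoord j)
        constructor <;> linarith [(hy1 j).1, (hy1 j).2]
      · have := abs_lt.1 (hcoord j)
        have hj := h j
        constructor <;> linarith [hj.1, hj.2]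
    refine (measure_mono hsub).trans ?_
    have hin : volume {x : Space d | ∀ j, x j ∈ Set.Ioo δ (L k - δ)} =
        ENNReal.ofReal ((L k - 2 * δ) ^ d) := by
      rw [volume_box]
      simp only [Real.volume_Ioo, Finset.prod_const, Finset.card_univ, Fintype.card_fin]
      rw [ENNReal.ofReal_pow (by linarith)]
      congr 2
      ring
    have hout : volume {x : Space d | ∀ j, x j ∈ Set.Icc (-δ) (L k + δ)} =
        ENNReal.ofReal ((L k + 2 * δ) ^ d) := by
      rw [volume_box]
      simp only [Real.volume_Icc, Finset.prod_const, Finset.card_univ, Fintype.card_fin]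
      rw [ENNReal.ofReal_pow (by linarith)]
      congr 2
      ring
    rw [measure_sdiff _ (measurableSet_box fun _ => measurableSet_Ioo).nullMeasurableSet
      (by rw [hin]; exact ENNReal.ofReal_ne_top), hin, hout, hvol,
      ← ENNReal.ofReal_sub _ (pow_nonneg (by linarith) d),
      ← ENNReal.ofReal_mul (sub_nonneg.2 (pow_le_pow_left₀ (by linarith) (by
        have : 0 < α * √d := by positivity
        linarith) d))]
    · refine ENNReal.ofReal_le_ofReal (le_of_eq ?_)
      rw [sub_mul, ← mul_pow, ← mul_pow, hδ]
      ring
    · intro x hx j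
      have hj := hx j
      constructor <;> linarith [hj.1, hj.2]

theorem thermodynamicLimit_of_cubes (hd : 0 < d) {ρ : ℝ} (hρ : 0 < ρ) {S : ℕ → Set (Space d)}
    (h1 : ∀ k : ℕ, {x : Space d | ∀ j, x j ∈ Set.Ioo 0 ((k : ℝ) + 1)} ⊆ S k)
    (h2 : ∀ k : ℕ, S k ⊆ {x : Space d | ∀ j, x j ∈ Set.Icc 0 ((k : ℝ) + 1)}) :
    ThermodynamicLimit S (fun k => ⌊ρ * ((k : ℝ) + 1) ^ d⌋₊) ρ := by
  have hL : Tendsto (fun k : ℕ => (k : ℝ) + 1) atTop atTop :=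
    tendsto_atTop_add_const_right _ _ tendsto_natCast_atTop_atTop
  obtain ⟨hvol, hF⟩ := tendsToInfinityFisher_of_cubes hd (fun k => by positivity) hL h1 h2
  refine ⟨hF, ?_⟩
  have := (tendsto_nat_floor_mul_div_atTop hρ.le).comp ((tendsto_pow_atTop hd.ne').comp hL)
  refine this.congr fun k => ?_
  simp only [Function.comp]
  rw [hvol, ENNReal.toReal_ofReal (by positivity)]

/-- `IsEnergyDensity` quantifies over thermodynamic limits and would say nothing about e without
one. -/
theorem exists_thermodynamicLimit_domain (hd : 0 < d) {ρ : ℝ} (hρ : 0 < ρ) :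
    ∃ (Λ : ℕ → Domain d) (n : ℕ → ℕ), ThermodynamicLimit (fun k => (Λ k).carrier) n ρ := by
  have hopen : ∀ k : ℕ, IsOpen {x : Space d | ∀ j, x j ∈ Set.Ioo 0 ((k : ℝ) + 1)} := by
    intro k
    have : {x : Space d | ∀ j, x j ∈ Set.Ioo 0 ((k : ℝ) + 1)} =
        ⋂ j, (fun x : Space d => x j) ⁻¹' Set.Ioo 0 ((k : ℝ) + 1) := by
      ext x; simp
    rw [this]
    exact isOpen_iInter_of_finite fun j => isOpen_Ioo.preimage (by fun_prop)
  have hbdd : ∀ k : ℕ, Bornology.IsBounded {x : Space d | ∀ j, x j ∈ Set.Ioo 0 ((k : ℝ) + 1)} := by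
    intro k
    refine (Metric.isBounded_closedBall (x := (0 : Space d)) (r := √(d * ((k : ℝ) + 1) ^ 2))).subset
      fun x hx => ?_
    rw [mem_closedBall_zero_iff, EuclideanSpace.norm_eq]
    refine Real.sqrt_le_sqrt ?_
    have h3 : ∀ j ∈ Finset.univ, ‖x j‖ ^ 2 ≤ ((k : ℝ) + 1) ^ 2 := fun j _ => by
      have := hx j
      rw [Real.norm_of_nonneg this.1.le]
      exact pow_le_pow_left₀ this.1.le this.2.le 2
    simpa using Finset.sum_le_card_nsmul _ _ _ h3
  exact ⟨fun k => ⟨_, hopen k, hbdd k⟩, _, thermodynamicLimit_of_cubes hd hρ (fun k => subset_rfl)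
    fun k x hx j => Set.Ioo_subset_Icc_self (hx j)⟩

theorem exists_thermodynamicLimit_cells (hd : 0 < d) {ρ : ℝ} (hρ : 0 < ρ) :
    ∃ (Λ : ℕ → Finset (Lattice d)) (n : ℕ → ℕ), ThermodynamicLimit (fun k => cells (Λ k)) n ρ := by
  refine ⟨fun k => Fintype.piFinset fun _ => Finset.Ico (0 : ℤ) (k + 1), _,
    thermodynamicLimit_of_cubes hd hρ (fun k x hx => ?_) fun k x hx j => ?_⟩
  · refine Fintype.mem_piFinset.2 fun j => Finset.mem_Ico.2 ⟨Int.floor_nonneg.2 (hx j).1.le, ?_⟩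
    rw [Int.floor_lt]
    exact_mod_cast (hx j).2
  · obtain ⟨h3, h4⟩ := Finset.mem_Ico.1 (Fintype.mem_piFinset.1 hx j)
    rw [Int.floor_lt] at h4
    refine ⟨Int.floor_nonneg.1 h3, ?_⟩
    exact_mod_cast h4.le

end Cubes

/-! ### Passage to the limit -/

section Density

variable {d : ℕ}

/-- Halving the constant leaves room for n/|Λ| to be merely close to ρ. As ρ > 0, the quotient is
eventually positive, so neither n nor the real-valued volume can be 0. -/
theorem eventually_energyConst_le (hd : 0 < d) {ρ : ℝ} (hρ : 0 < ρ) {S : ℕ → Set (Space d)}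
    {n : ℕ → ℕ} (h : ThermodynamicLimit S n ρ) :
    ∀ᶠ k in atTop, 0 < n k ∧ 0 < (volume (S k)).toReal ∧
      energyConst d / 2 * ρ ^ (2 / (d : ℝ)) ≤
        energyConst d * (n k / (volume (S k)).toReal) ^ (2 / (d : ℝ)) := by
  have hc := energyConst_pos hd
  have hlim : Tendsto (fun k => energyConst d * ((n k : ℝ) / (volume (S k)).toReal) ^ (2 / (d : ℝ)))
      atTop (𝓝 (energyConst d * ρ ^ (2 / (d : ℝ)))) :=
    (h.2.rpow_const (Or.inl hρ.ne')).const_mul _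
  have hlt : energyConst d / 2 * ρ ^ (2 / (d : ℝ)) < energyConst d * ρ ^ (2 / (d : ℝ)) :=
    mul_lt_mul_of_pos_right (half_lt_self hc) (Real.rpow_pos_of_pos hρ _)
  filter_upwards [hlim.eventually_const_lt hlt, h.2.eventually_const_lt hρ] with k h1 h2
  refine ⟨Nat.pos_of_ne_zero fun h0 => ?_, ENNReal.toReal_nonneg.lt_of_ne fun h0 => ?_, h1.le⟩
  · simp [h0] at h2
  · simp [← h0] at h2

/-- If e < b, then `Set.Iio b` is a neighbourhood of e which the quotients eventually avoid almost
surely; this probability 1 cannot tend to 0. -/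
theorem IsEnergyDensity.le {Ω : Type*} [MeasurableSpace Ω] {P : Measure Ω} [IsProbabilityMeasure P]
    {D : Type} {region : D → Set (Space d)} {𝓔 : Ω → D → ℕ → EReal} {ρ : ℝ} {e b : EReal}
    (he : IsEnergyDensity P region 𝓔 ρ e) {Λ : ℕ → D} {n : ℕ → ℕ}
    (hlim : ThermodynamicLimit (fun k => region (Λ k)) n ρ)
    (hb : ∀ᶠ k in atTop, ∀ᵐ ω ∂P, b ≤ 𝓔 ω (Λ k) (n k) / ((n k : ℝ) : EReal)) : b ≤ e := by
  by_contra! hlt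
  have h0 := he Λ n hlim (Set.Iio b) (Iio_mem_nhds hlt)
  have h1 : ∀ᶠ k in atTop,
      P {ω | 𝓔 ω (Λ k) (n k) / ((n k : ℝ) : EReal) ∉ Set.Iio b} = 1 := by
    filter_upwards [hb] with k hk
    refine (measure_congr (eventuallyEq_univ.2 ?_)).trans measure_univ
    filter_upwards [hk] with ω hω using not_lt.2 hω
  have h2 := h0.congr' h1
  exact one_ne_zero (tendsto_nhds_unique tendsto_const_nhds h2)

end Density

end FermionGas

/-! ### Both models together -/

theorem mainTheorem7 (d : ℕ) (hd : 0 < d) :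
    ∃ β : ℝ, 0 < β ∧
      ∀ (Ω : Type*) [MeasurableSpace Ω] (P : Measure Ω) [IsProbabilityMeasure P]
        (ρ : ℝ), 0 < ρ →
        -- continuum model
        (∀ V : Ω → FermionGas.Space d → ℝ,
          (∀ᵐ ω ∂P, ∀ᵐ x, 0 ≤ V ω x) →
          (∀ e : EReal,
            FermionGas.IsEnergyDensity P FermionGas.Domain.carrier
              (fun ω Λ n => FermionGas.groundEnergy (V ω) Λ n) ρ e →
            ((β * ρ ^ (2 / (d : ℝ)) : ℝ) : EReal) ≤ e) ∧
          (∀ᵐ ω ∂P, ∀ (Λ : ℕ → FermionGas.Domain d) (n : ℕ → ℕ),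
            FermionGas.ThermodynamicLimit (fun k => (Λ k).carrier) n ρ →
            ((β * ρ ^ (2 / (d : ℝ)) : ℝ) : EReal) ≤
              liminf (fun k => FermionGas.groundEnergy (V ω) (Λ k) (n k) /
                ((n k : ℝ) : EReal)) atTop)) ∧
        -- lattice model
        (∀ V : Ω → FermionGas.Lattice d → ℝ,
          (∀ᵐ ω ∂P, ∀ x, 0 ≤ V ω x) →
          (∀ e : EReal,
            FermionGas.IsEnergyDensity P FermionGas.cells
              (fun ω Λ n => FermionGas.latticeGroundEnergy (V ω) Λ n) ρ e →
            ((β * ρ ^ (2 / (d : ℝ)) : ℝ) : EReal) ≤ e) ∧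
          (∀ᵐ ω ∂P, ∀ (Λ : ℕ → Finset (FermionGas.Lattice d)) (n : ℕ → ℕ),
            FermionGas.ThermodynamicLimit (fun k => FermionGas.cells (Λ k)) n ρ →
            ((β * ρ ^ (2 / (d : ℝ)) : ℝ) : EReal) ≤
              liminf (fun k => FermionGas.latticeGroundEnergy (V ω) (Λ k) (n k) /
                ((n k : ℝ) : EReal)) atTop)) := by
  refine ⟨FermionGas.energyConst d / 2, half_pos (FermionGas.energyConst_pos hd),
    fun Ω _ P _ ρ hρ => ⟨fun V hV => ?_, fun V hV => ?_⟩⟩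
  -- The threshold in k does not depend on ω, and the only exceptional ω are those with a potential
  -- that is not nonnegative; so one null set serves all sequences.
  · have hbound : ∀ (Λ : ℕ → FermionGas.Domain d) (n : ℕ → ℕ),
        FermionGas.ThermodynamicLimit (fun k => (Λ k).carrier) n ρ → ∀ᶠ k in atTop,
        ∀ ω, (∀ᵐ x, 0 ≤ V ω x) →
          ((FermionGas.energyConst d / 2 * ρ ^ (2 / (d : ℝ)) : ℝ) : EReal) ≤
            FermionGas.groundEnergy (V ω) (Λ k) (n k) / ((n k : ℝ) : EReal) := by
      intro Λ n hlim
      filter_upwards [FermionGas.eventually_energyConst_le hd hρ hlim] with k hk ω hω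
      exact (EReal.coe_le_coe_iff.2 hk.2.2).trans
        (FermionGas.groundEnergy_ge hd hω (Λ k) hk.1 hk.2.1)
    refine ⟨fun e he => ?_, ?_⟩
    · obtain ⟨Λ, n, hlim⟩ := FermionGas.exists_thermodynamicLimit_domain hd hρ
      refine he.le hlim ?_
      filter_upwards [hbound Λ n hlim] with k hk
      filter_upwards [hV] with ω hω using hk ω hω
    · filter_upwards [hV] with ω hω Λ n hlim
      refine le_liminf_of_le (by isBoundedDefault) ?_
      filter_upwards [hbound Λ n hlim] with k hk using hk ω hω
  · have hbound : ∀ (Λ : ℕ → Finset (FermionGas.Lattice d)) (n : ℕ → ℕ),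
        FermionGas.ThermodynamicLimit (fun k => FermionGas.cells (Λ k)) n ρ → ∀ᶠ k in atTop,
        ∀ ω, (∀ x, 0 ≤ V ω x) →
          ((FermionGas.energyConst d / 2 * ρ ^ (2 / (d : ℝ)) : ℝ) : EReal) ≤
            FermionGas.latticeGroundEnergy (V ω) (Λ k) (n k) / ((n k : ℝ) : EReal) := by
      intro Λ n hlim
      filter_upwards [FermionGas.eventually_energyConst_le hd hρ hlim] with k hk ω hω
      have h1 := hk.2.2
      rw [FermionGas.volume_cells, ENNReal.toReal_natCast] at h1
      exact (EReal.coe_le_coe_iff.2 h1).trans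
        (FermionGas.latticeGroundEnergy_ge hd hω (Λ k) hk.1)
    refine ⟨fun e he => ?_, ?_⟩
    · obtain ⟨Λ, n, hlim⟩ := FermionGas.exists_thermodynamicLimit_cells hd hρ
      refine he.le hlim ?_
      filter_upwards [hbound Λ n hlim] with k hk
      filter_upwards [hV] with ω hω using hk ω hω
    · filter_upwards [hV] with ω hω Λ n hlim
      refine le_liminf_of_le (by isBoundedDefault) ?_
      filter_upwards [hbound Λ n hlim] with k hk using hk ω hω
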